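/- In the problem Basis Sequence Reconfiguration, the input consists of matroids $M_1=(E_1,\mathcal B_1),\dots,M_k=(E_k,\mathcal B_k)$ on finite, not necessarily disjoint ground sets $E_1,\dots,E_k\subseteq E$, each given by a basis oracle (which decides for $i$ and $X\subseteq E$ whether $X\in\mathcal B_i$), and two feasible basis sequences $\mathbb B=(B_1,\dots,B_k)$ and $\mathbb B'=(B_1',\dots,B_k')$, where a tuple $(B_1,\dots,B_k)$ is a feasible basis sequence if $B_i\in\mathcal B_i$ for all $i$ and $B_i\cap B_j=\emptyset$ for $i\neq j$. Two feasible basis sequences $\mathbb B$, $\mathbb B'$ are adjacent if there is an $i$ with $B_j=B'_j$ for all $j\ne i$ and $B'_i=(B_i\setminus\{x\})\cup\{y\}$ for some $x\in B_i$ and $y\in E_i\setminus B_i$. A reconfiguration sequence of length $\ell$ between $\mathbb B$ and $\mathbb B'$ is a sequence of feasible basis sequences $\mathbb B_0,\dots,\mathbb B_\ell$ with $\mathbb B_0=\mathbb B$, $\mathbb B_\ell=\mathbb B'$ and $\mathbb B_{t-1}$, $\mathbb B_t$ adjacent for $1\le t\le\ell$. The question is whether such a sequence exists. Theorem. There is a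 deterministic algorithm (a program of a unit-cost random access machine whose only arithmetic operation is the successor function, with two-dimensional arrays and with basis oracles) that decides Basis Sequence Reconfiguration in polynomial time: on every instance it halts after $O((|E|+1)^3)$ steps and $O(|E|^3)$ oracle calls with the correct answer, where an oracle call counts as one step and asks about a set whose characteristic vector is stored in memory. If the answer is yes, then within the same bounds it also outputs a reconfiguration sequence between $\mathbb B$ and $\mathbb B'$ of length $O(|E|^2)$. Here every tuple of disjoint sets in the input and in the output is stored as an array that gives for each $x\in E$ the index of the set that contains $x$, or states that there is none. The constants are absolute; in particular they do not depend on $k$. -/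

import Mathlib

/-! ### Basis sequences of matroids and their reconfiguration -/

section Reconfiguration

variable {n k : ℕ}

/-- A tuple `B` is a feasible basis sequence of the tuple `M` of matroids: every `B i` is a basis
of `M i`, and the sets `B i` are pairwise disjoint. The ground set of `M i` is `(M i).E`, an
arbitrary subset of `Fin n`. -/
def Feasible (M : Fin k → Matroid (Fin n)) (B : Fin k → Set (Fin n)) : Prop :=
  (∀ i, (M i).IsBase (B i)) ∧ ∀ i j, i ≠ j → Disjoint (B i) (B j)

/-- `B'` arises from `B` by replacing one set `B i` by `B i - x + y`, for some `x ∈ B i` and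
`y ∈ E i \ B i`. -/
def Adjacent (M : Fin k → Matroid (Fin n)) (B B' : Fin k → Set (Fin n)) : Prop :=
  ∃ i, (∀ j, j ≠ i → B j = B' j) ∧
    ∃ x ∈ B i, ∃ y ∈ (M i).E \ B i, B' i = insert y (B i \ {x})

/-- `S 0, …, S ℓ` is a reconfiguration sequence of length `ℓ` between `B` and `B'`. -/
def IsReconfSeq (M : Fin k → Matroid (Fin n)) (B B' : Fin k → Set (Fin n)) (ℓ : ℕ)
    (S : ℕ → Fin k → Set (Fin n)) : Prop :=
  S 0 = B ∧ S ℓ = B' ∧ (∀ t ≤ ℓ, Feasible M (S t)) ∧ ∀ t < ℓ, Adjacent M (S t) (S (t + 1))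

/-- `B` is reconfigurable to `B'`. -/
def Reconfigurable (M : Fin k → Matroid (Fin n)) (B B' : Fin k → Set (Fin n)) : Prop :=
  ∃ ℓ S, IsReconfSeq M B B' ℓ S

end Reconfiguration

/-! ### A random access machine with an oracle

Programs are finite pieces of syntax. The only arithmetic is the successor function, so a value
that occurs in a run of `T` steps exceeds the largest input value and the largest literal of the
program by at most `T`: unit cost does not hide computations on long words. -/

/-- The memory: registers `reg r` and two-dimensional arrays `arr a`, holding natural numbers. -/
structure Store where
  /-- the registers -/
  reg : ℕ → ℕ
  /-- the arrays: `arr a i j` is the cell `(i, j)` of the array `a` -/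
  arr : ℕ → ℕ → ℕ → ℕ

/-- Memory after writing `v` to register `r`. -/
def Store.setReg (s : Store) (r v : ℕ) : Store :=
  { s with reg := Function.update s.reg r v }

/-- Memory after writing `v` to the cell `(i, j)` of array `a`. -/
def Store.setArr (s : Store) (a i j v : ℕ) : Store :=
  { s with arr := fun a' i' j' => if a' = a ∧ i' = i ∧ j' = j then v else s.arr a' i' j' }

/-- Expressions: literals, registers, successor, and array access (with computed indices). -/
inductive Expr where
  | lit (c : ℕ)
  | reg (r : ℕ)
  | succ (e : Expr)
  | get (a : ℕ) (e₁ e₂ : Expr)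

/-- The value of an expression. -/
def Expr.val (s : Store) : Expr → ℕ
  | .lit c => c
  | .reg r => s.reg r
  | .succ e => e.val s + 1
  | .get a e₁ e₂ => s.arr a (e₁.val s) (e₂.val s)

/-- The number of steps needed to evaluate an expression: one for each operation in it. -/
def Expr.cost : Expr → ℕ
  | .lit _ => 1
  | .reg _ => 1
  | .succ e => e.cost + 1
  | .get _ e₁ e₂ => e₁.cost + e₂.cost + 1

/-- Tests for branching. -/
inductive Test where
  | eq (e₁ e₂ : Expr)
  | lt (e₁ e₂ : Expr)
  | not (b : Test)
  | and (b₁ b₂ : Test)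

/-- Truth of a test. -/
def Test.holds (s : Store) : Test → Prop
  | .eq e₁ e₂ => e₁.val s = e₂.val s
  | .lt e₁ e₂ => e₁.val s < e₂.val s
  | .not b => ¬ b.holds s
  | .and b₁ b₂ => b₁.holds s ∧ b₂.holds s

/-- The number of steps needed to evaluate a test: one for each operation in it. -/
def Test.cost : Test → ℕ
  | .eq e₁ e₂ => e₁.cost + e₂.cost + 1
  | .lt e₁ e₂ => e₁.cost + e₂.cost + 1
  | .not b => b.cost + 1
  | .and b₁ b₂ => b₁.cost + b₂.cost + 1

/-- Programs. `ask r e a e'` puts the question "is the set whose characteristic vector is stored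
in row `e'` of array `a` a basis of matroid number `e`?" to the oracle, and stores the answer (`1`
for yes, `0` for no) in register `r`. -/
inductive Prog where
  | skip
  | set (r : ℕ) (e : Expr)
  | put (a : ℕ) (e₁ e₂ e : Expr)
  | ask (r : ℕ) (e : Expr) (a : ℕ) (e' : Expr)
  | seq (p q : Prog)
  | ite (b : Test) (p q : Prog)
  | loop (b : Test) (p : Prog)

/-- `Exec O p s s' T Q`: started in memory `s`, with oracle `O`, the program `p` halts in memory
`s'` after exactly `T` steps and `Q` oracle calls. An oracle call itself is one step. `loop b p` is
"while `b` do `p`". -/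
inductive Exec (O : ℕ → Set ℕ → Prop) : Prog → Store → Store → ℕ → ℕ → Prop where
  | skip (s : Store) : Exec O .skip s s 1 0
  | set (s : Store) (r : ℕ) (e : Expr) :
      Exec O (.set r e) s (s.setReg r (e.val s)) (e.cost + 1) 0
  | put (s : Store) (a : ℕ) (e₁ e₂ e : Expr) :
      Exec O (.put a e₁ e₂ e) s (s.setArr a (e₁.val s) (e₂.val s) (e.val s))
        (e₁.cost + e₂.cost + e.cost + 1) 0
  | ask_yes (s : Store) (r : ℕ) (e : Expr) (a : ℕ) (e' : Expr)
      (h : O (e.val s) {x | s.arr a (e'.val s) x ≠ 0}) :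
      Exec O (.ask r e a e') s (s.setReg r 1) (e.cost + e'.cost + 1) 1
  | ask_no (s : Store) (r : ℕ) (e : Expr) (a : ℕ) (e' : Expr)
      (h : ¬ O (e.val s) {x | s.arr a (e'.val s) x ≠ 0}) :
      Exec O (.ask r e a e') s (s.setReg r 0) (e.cost + e'.cost + 1) 1
  | seq {p q : Prog} {s₁ s₂ s₃ : Store} {T₁ T₂ Q₁ Q₂ : ℕ}
      (h₁ : Exec O p s₁ s₂ T₁ Q₁) (h₂ : Exec O q s₂ s₃ T₂ Q₂) :
      Exec O (.seq p q) s₁ s₃ (T₁ + T₂) (Q₁ + Q₂)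
  | ite_true {b : Test} {p q : Prog} {s s' : Store} {T Q : ℕ}
      (hb : b.holds s) (h : Exec O p s s' T Q) : Exec O (.ite b p q) s s' (b.cost + T) Q
  | ite_false {b : Test} {p q : Prog} {s s' : Store} {T Q : ℕ}
      (hb : ¬ b.holds s) (h : Exec O q s s' T Q) : Exec O (.ite b p q) s s' (b.cost + T) Q
  | loop_true {b : Test} {p : Prog} {s₁ s₂ s₃ : Store} {T₁ T₂ Q₁ Q₂ : ℕ}
      (hb : b.holds s₁) (h₁ : Exec O p s₁ s₂ T₁ Q₁) (h₂ : Exec O (.loop b p) s₂ s₃ T₂ Q₂) :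
      Exec O (.loop b p) s₁ s₃ (b.cost + T₁ + T₂) (Q₁ + Q₂)
  | loop_false {b : Test} {p : Prog} {s : Store} (hb : ¬ b.holds s) :
      Exec O (.loop b p) s s b.cost 0

/-! ### Instances as inputs of the machine -/

section Encoding

variable {n k : ℕ}

/-- The basis oracles of `M 0, …, M (k - 1)`: the answer to `(i, X)` is yes if and only if `X` is a
basis of `M i`. Cells of the characteristic vector beyond the first `n` are not read. -/
def basisOracle (M : Fin k → Matroid (Fin n)) (i : ℕ) (X : Set ℕ) : Prop :=
  ∃ h : i < k, (M ⟨i, h⟩).IsBase {x : Fin n | (x : ℕ) ∈ X}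

open Classical in
/-- The encoding of a tuple of disjoint sets by the index of the set that contains `x`; the value
is `k` if `x` lies in none of the sets. -/
noncomputable def label (B : Fin k → Set (Fin n)) (x : ℕ) : ℕ :=
  if h : ∃ i : Fin k, ∃ hx : x < n, (⟨x, hx⟩ : Fin n) ∈ B i then (h.choose : ℕ) else k

open Classical in
/-- The table of the ground sets: the entry `(i, x)` is `1` if `x` belongs to the ground set of
`M i`, and `0` otherwise. -/
noncomputable def groundTable (M : Fin k → Matroid (Fin n)) (i x : ℕ) : ℕ :=
  if ∃ (hi : i < k) (hx : x < n), (⟨x, hx⟩ : Fin n) ∈ (M ⟨i, hi⟩).E then 1 else 0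

/-- The initial memory: `n` and `k` in the registers `0` and `1`, the ground sets in array `0`, `B`
in row `0` of array `1`, and `B'` in row `0` of array `2`. All other cells are `0`; the bases of
the matroids are accessible only through the oracle. -/
noncomputable def initStore (M : Fin k → Matroid (Fin n)) (B B' : Fin k → Set (Fin n)) : Store where
  reg r := if r = 0 then n else if r = 1 then k else 0
  arr a i x :=
    if a = 0 then groundTable M i x
    else if a = 1 ∧ i = 0 ∧ x < n then label B x
    else if a = 2 ∧ i = 0 ∧ x < n then label B' x
    else 0

/-- The final memory `s` contains the sequence `S 0, …, S ℓ`: its length `ℓ` is in register `1`,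
and `S t` is in row `t` of array `3`, for `t ≤ ℓ`. -/
def Outputs (s : Store) (ℓ : ℕ) (S : ℕ → Fin k → Set (Fin n)) : Prop :=
  s.reg 1 = ℓ ∧ ∀ t ≤ ℓ, ∀ x < n, s.arr 3 t x = label (S t) x

end Encoding

/-!
# Reconfiguration of basis sequences in polynomial time

A tuple of disjoint bases is encoded by a labelling `f : Fin n → ℕ`, where `f x` is the index of the
basis that contains `x`, or `k` if `x` is free. The exchange graph of `f` has an arc from `x` to `y`
if `x` can be exchanged for `y` in the basis that contains `x`; a step of a reconfiguration sequence
is an arc to a free element. If there is a path to a free element without chords, the exchanges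
along it can be made one after the other, beginning at the free end (`IsShiftPath.exchange`).

The algorithm transforms the two given labellings `f` and `g` until they are equal. The number of
elements of the bases of `f` that `g` labels differently decreases in every iteration, so there are
at most `n` iterations besides the last one.

* If some `y` is free in `f` but has the label `i` in `g`, then some element of label `i` in `f`,
  but not in `g`, can be exchanged for `y` (`exists_arc_of_label`).
* Otherwise let `D` be the set of the elements on which `f` and `g` differ. A breadth-first search
  from `D` in the exchange graph of `f` processes `D` first, so the path from `D` to a free element
  found by the search has no chords, and apart from its first two vertices, none is entered by an
  arc from `D`. An element `y` that is entered by no arc from `D` is spanned by the common part of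
  the bases `i` of `f` and `g`, for every `i` with `y` in the ground set and outside of these bases.
  Hence the arcs that enter it are the same for `f` and `g` (`arc_iff_arc`). It follows that the
  path is also a path for `g`, except that its first vertex has to be replaced by an element of `D`
  whose label in `g` is the label of the first vertex in `f` (`exists_arc_of_arc`). After shifting `f` and `g` along their
  paths, they agree on all vertices of the path that lie outside of `D`, and the first vertex of the
  path is free in `f` (`discrepancy_shift_lt`).
* If the search reaches no free element, then the set of the visited elements is left by no arc.
  A rank computation shows that no sequence of steps ever moves an element of such a set
  (`inter_eq_of_reflTransGen`); as it contains `D`, there is no reconfiguration sequence.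

Each iteration adds at most `n` steps to each of the two sequences, and takes `O(n ^ 2)` time: the
search asks the oracle at most once for each pair of elements, and each step of the sequences is
recorded in time `O(n)`. The time bounds are read off from the text of the program: apart from the
output of the final sequence, every loop makes at most `n + 1` iterations, and the loops are nested
at most three deep (`Prog.bound_le`).
-/

/-! ### Exchanges in a matroid -/

section Exchange

variable {α : Type*} {M : Matroid α} {B S : Set α} {x y u v : α}

theorem isBase_exchange_iff (hB : M.IsBase B) (hx : x ∈ B) (hy : y ∉ B) :
    M.IsBase (insert y (B \ {x})) ↔ y ∈ M.E ∧ y ∉ M.closure (B \ {x}) := by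
  have hI : M.Indep (B \ {x}) := hB.indep.subset Set.sdiff_subset
  have hy' : y ∉ B \ {x} := fun h => hy h.1
  constructor
  · intro h
    exact (hI.insert_indep_iff_of_notMem hy').1 h.indep
  · intro h
    have hyx : y ≠ x := fun e => hy (e ▸ hx)
    rw [Set.insert_sdiff_singleton_comm hyx]
    refine hB.exchange_isBase_of_indep' hx hy ?_
    rw [← Set.insert_sdiff_singleton_comm hyx]
    exact (hI.insert_indep_iff_of_notMem hy').2 h

/-- An element spanned by `B \ {x}` for every `x ∈ B` outside of `S` is spanned by `S`. -/
theorem mem_closure_of_forall_sdiff (hB : M.IsBase B) (hS : S ⊆ B) (hy : y ∈ M.E)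
    (h : ∀ x ∈ B \ S, y ∈ M.closure (B \ {x})) : y ∈ M.closure S := by
  rcases (B \ S).eq_empty_or_nonempty with h0 | hne
  · rw [Set.sdiff_eq_empty] at h0
    rw [hS.antisymm h0, hB.closure_eq]
    exact hy
  · have hcl := hB.indep.closure_sInter_eq_biInter_closure_of_forall_subset
      (Js := (fun x => B \ {x}) '' (B \ S)) (hne.image _)
      (by rintro _ ⟨x, -, rfl⟩; exact Set.sdiff_subset)
    have hEq : ⋂₀ ((fun x => B \ {x}) '' (B \ S)) = S := by
      ext z
      simp only [Set.sInter_image, Set.mem_iInter, Set.mem_sdiff, Set.mem_singleton_iff]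
      constructor
      · intro hz
        by_contra hzS
        obtain ⟨w, hw⟩ := hne
        have hzB := (hz w hw).1
        exact (hz z ⟨hzB, hzS⟩).2 rfl
      · rintro hz w ⟨-, hw⟩
        exact ⟨hS hz, fun e => hw (e ▸ hz)⟩
    rw [hEq] at hcl
    rw [hcl]
    simpa using fun x hx hxS => h x ⟨hx, hxS⟩

/-- After the exchange of `x` for `y`, the set obtained by deleting `u` has the same closure as
before, provided that `u` could not be exchanged for `y`. -/
theorem closure_sdiff_exchange (hB : M.IsBase B) (hx : x ∈ B) (hu : u ∈ B) (hxu : u ≠ x)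
    (hy : y ∉ B) (hxy : M.IsBase (insert y (B \ {x}))) (huy : ¬ M.IsBase (insert y (B \ {u}))) :
    M.closure (insert y (B \ {x}) \ {u}) = M.closure (B \ {u}) := by
  have h1 := (isBase_exchange_iff hB hx hy).1 hxy
  have h2 : y ∈ M.closure (B \ {u}) := by
    by_contra h
    exact huy ((isBase_exchange_iff hB hu hy).2 ⟨h1.1, h⟩)
  have e1 : B \ {u} = insert x ((B \ {x}) \ {u}) := by
    ext z
    simp only [Set.mem_sdiff, Set.mem_singleton_iff, Set.mem_insert_iff]
    constructor
    · rintro ⟨a, b⟩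
      by_cases hz : z = x
      · exact Or.inl hz
      · exact Or.inr ⟨⟨a, hz⟩, b⟩
    · rintro (rfl | ⟨⟨a, -⟩, b⟩)
      · exact ⟨hx, hxu.symm⟩
      · exact ⟨a, b⟩
  have e2 : insert y (B \ {x}) \ {u} = insert y ((B \ {x}) \ {u}) := by
    rw [Set.insert_sdiff_of_notMem]
    rintro rfl
    exact hy hu
  rw [e1] at h2
  rw [e1, e2]
  refine Matroid.closure_insert_congr ⟨h2, fun h => h1.2 ?_⟩
  exact M.closure_subset_closure Set.sdiff_subset h

/-- An exchange of `x` for `y` does not change whether `u` can be exchanged for `v`, if `u` could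
not be exchanged for `y`. -/
theorem isBase_exchange_exchange_iff (hB : M.IsBase B) (hx : x ∈ B) (hu : u ∈ B) (hxu : u ≠ x)
    (hy : y ∉ B) (hv : v ∉ B) (hvy : v ≠ y) (hxy : M.IsBase (insert y (B \ {x})))
    (huy : ¬ M.IsBase (insert y (B \ {u}))) :
    M.IsBase (insert v (insert y (B \ {x}) \ {u})) ↔ M.IsBase (insert v (B \ {u})) := by
  rw [isBase_exchange_iff hB hu hv, isBase_exchange_iff hxy (by simp [hu, hxu]) (by simp [hv, hvy]),
    closure_sdiff_exchange hB hx hu hxu hy hxy huy]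

end Exchange

/-! ### Labellings and the exchange graph -/

section ExchangeGraph

variable {n k : ℕ}

/-- The tuple of sets that a labelling `f` describes. -/
def classes (k : ℕ) (f : Fin n → ℕ) (i : Fin k) : Set (Fin n) := {z | f z = i}

/-- A labelling that describes a feasible basis sequence; the elements with label `k` are the free
ones, which lie in none of the sets. -/
structure IsBaseLabelling (M : Fin k → Matroid (Fin n)) (f : Fin n → ℕ) : Prop where
  le : ∀ x, f x ≤ k
  isBase : ∀ i, (M i).IsBase (classes k f i)

/-- The arcs of the exchange graph of `f`: the element `x` can be exchanged for `y` in the basis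
that contains `x`. The element `y` may belong to another basis. -/
def Arc (M : Fin k → Matroid (Fin n)) (f : Fin n → ℕ) (x y : Fin n) : Prop :=
  f y ≠ f x ∧ ∃ h : f x < k, (M ⟨f x, h⟩).IsBase (insert y (classes k f ⟨f x, h⟩ \ {x}))

/-- The labelling after the exchange of `x` for the free element `y`. -/
def exchange (k : ℕ) (f : Fin n → ℕ) (x y : Fin n) : Fin n → ℕ :=
  Function.update (Function.update f x k) y (f x)

variable {M : Fin k → Matroid (Fin n)} {f g h : Fin n → ℕ} {x y u v : Fin n}

@[simp] theorem mem_classes {i : Fin k} : x ∈ classes k f i ↔ f x = i := Iff.rfl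

theorem exchange_right : exchange k f x y y = f x := by simp [exchange]

theorem exchange_left (h : x ≠ y) : exchange k f x y x = k := by simp [exchange, h]

theorem exchange_of_ne (hx : u ≠ x) (hy : u ≠ y) : exchange k f x y u = f u := by
  simp [exchange, hx, hy]

theorem Arc.ne (h : Arc M f x y) : x ≠ y := fun e => h.1 (e ▸ rfl)

theorem Arc.lt (h : Arc M f x y) : f x < k := h.2.1

theorem arc_iff_isBase {i : Fin k} (hx : f x = i) (hy : f y ≠ i) :
    Arc M f x y ↔ (M i).IsBase (insert y (classes k f i \ {x})) := by
  obtain ⟨i, hi⟩ := i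
  subst hx
  exact ⟨fun h => h.2.2, fun h => ⟨hy, hi, h⟩⟩

theorem arc_iff (hf : IsBaseLabelling M f) {i : Fin k} (hx : f x = i) (hy : f y ≠ i) :
    Arc M f x y ↔ y ∈ (M i).E ∧ y ∉ (M i).closure (classes k f i \ {x}) := by
  rw [arc_iff_isBase hx hy, isBase_exchange_iff (hf.isBase i) hx hy]

theorem classes_exchange (hxy : x ≠ y) (hy : f y = k) {i : Fin k} (hi : f x = i) :
    classes k (exchange k f x y) i = insert y (classes k f i \ {x}) := by
  ext z
  have := i.2
  simp only [mem_classes, Set.mem_insert_iff, Set.mem_sdiff, Set.mem_singleton_iff]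
  by_cases h1 : z = y
  · subst h1; simp [exchange_right, hi]
  · by_cases h2 : z = x
    · subst h2; simp [exchange_left hxy, h1]; omega
    · simp [exchange_of_ne h2 h1, h1, h2]

theorem classes_exchange_of_ne (hxy : x ≠ y) (hy : f y = k) {i : Fin k} (hi : f x ≠ i) :
    classes k (exchange k f x y) i = classes k f i := by
  ext z
  have := i.2
  simp only [mem_classes]
  by_cases h1 : z = y
  · subst h1; simp [exchange_right, hi, hy]; omega
  · by_cases h2 : z = x
    · subst h2; simp [exchange_left hxy, hi]; omega
    · simp [exchange_of_ne h2 h1]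

theorem IsBaseLabelling.exchange (hf : IsBaseLabelling M f) (h : Arc M f x y) (hy : f y = k) :
    IsBaseLabelling M (exchange k f x y) := by
  constructor
  · intro z
    by_cases h1 : z = y
    · subst h1; rw [exchange_right]; exact hf.le x
    · by_cases h2 : z = x
      · subst h2; rw [exchange_left h1]
      · rw [exchange_of_ne h2 h1]; exact hf.le z
  · intro i
    by_cases hi : f x = i
    · rw [classes_exchange h.ne hy hi]
      exact (arc_iff_isBase hi (by have := i.2; omega)).1 h
    · rw [classes_exchange_of_ne h.ne hy hi]
      exact hf.isBase i

theorem IsBaseLabelling.feasible (hf : IsBaseLabelling M f) : Feasible M (classes k f) := by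
  refine ⟨hf.isBase, fun i j hij => Set.disjoint_left.2 fun z hi hj => hij ?_⟩
  exact Fin.ext (hi.symm.trans hj)

theorem adjacent_exchange (hf : IsBaseLabelling M f) (h : Arc M f x y) (hy : f y = k) :
    Adjacent M (classes k f) (classes k (exchange k f x y)) := by
  have hyx : f y ≠ (⟨f x, h.lt⟩ : Fin k) := h.1
  refine ⟨⟨f x, h.lt⟩, fun j hj => (classes_exchange_of_ne h.ne hy ?_).symm, x, rfl, y,
    ⟨((arc_iff hf rfl hyx).1 h).1, hyx⟩, classes_exchange h.ne hy rfl⟩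
  rintro e
  exact hj (Fin.ext e.symm)

/-- If `u` cannot be exchanged for `y`, then the exchange of `x` for the free element `y` changes
no arc that leaves `u`, except possibly the arc to `y`. -/
theorem arc_exchange_iff (hf : IsBaseLabelling M f) (h : Arc M f x y) (hy : f y = k) (hux : u ≠ x)
    (huy : u ≠ y) (hvy : v ≠ y) (hn : ¬ Arc M f u y) :
    Arc M (exchange k f x y) u v ↔ Arc M f u v := by
  have hu' : exchange k f x y u = f u := exchange_of_ne hux huy
  by_cases hk : f u < k
  swap
  · exact ⟨fun h => absurd (hu' ▸ h.lt) hk, fun h => absurd h.lt hk⟩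
  obtain ⟨i, hi⟩ : ∃ i : Fin k, f u = i := ⟨⟨f u, hk⟩, rfl⟩
  have hyi : f y ≠ i := by have := i.2; omega
  have hn' := fun hb => hn ((arc_iff_isBase hi hyi).2 hb)
  by_cases hvi : exchange k f x y v = i
  · -- the label of `v` changes at most if `v = x`, so `v` carries the label of `u` before as well
    have hvx : v ≠ x := by
      rintro rfl
      rw [exchange_left h.ne] at hvi
      have := i.2
      omega
    rw [exchange_of_ne hvx hvy] at hvi
    refine ⟨fun h' => (h'.1 ?_).elim, fun h' => (h'.1 (hvi.trans hi.symm)).elim⟩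
    rw [hu', exchange_of_ne hvx hvy, hvi, hi]
  rw [arc_iff_isBase (hu'.trans hi) hvi]
  by_cases hxi : f x = i
  · rw [classes_exchange h.ne hy hxi]
    have hb := (arc_iff_isBase hxi hyi).1 h
    by_cases hvx : v = x
    · subst hvx
      have e : insert v (insert y (classes k f i \ {v}) \ {u}) =
          insert y (classes k f i \ {u}) := by
        ext z
        simp only [Set.mem_insert_iff, Set.mem_sdiff, Set.mem_singleton_iff, mem_classes]
        by_cases hz : z = v
        · subst hz; simp [hxi, hux.symm]
        · by_cases hz' : z = y
          · subst hz'; simp [huy.symm]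
          · simp [hz, hz']
      rw [e]
      exact ⟨fun h' => (hn' h').elim, fun h' => (h'.1 (hxi.trans hi.symm)).elim⟩
    · rw [exchange_of_ne hvx hvy] at hvi
      rw [arc_iff_isBase hi hvi]
      exact isBase_exchange_exchange_iff (hf.isBase i) hxi hi hux hyi hvi hvy hb hn'
  · rw [classes_exchange_of_ne h.ne hy hxi]
    have hvi' : f v ≠ i := by
      by_cases hvx : v = x
      · rwa [hvx]
      · rwa [exchange_of_ne hvx hvy] at hvi
    rw [arc_iff_isBase hi hvi']

/-! ### Comparison of two labellings -/

/-- An element that no differing element of label `i` can be exchanged for is spanned by the common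
part of the two bases number `i`. -/
theorem mem_closure_inter (hf : IsBaseLabelling M f) {i : Fin k} (hy : f y ≠ i) (hE : y ∈ (M i).E)
    (h : ∀ z, f z = i → g z ≠ i → ¬ Arc M f z y) :
    y ∈ (M i).closure (classes k f i ∩ classes k g i) := by
  refine mem_closure_of_forall_sdiff (hf.isBase i) Set.inter_subset_left hE fun z hz => ?_
  by_contra hc
  exact h z hz.1 (fun e => hz.2 ⟨hz.1, e⟩) ((arc_iff hf hz.1 hy).2 ⟨hE, hc⟩)

/-- If `g` gives the label `i` to an element `y` that `f` does not, then some element of label `i`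
in `f` but not in `g` can be exchanged for `y`. -/
theorem exists_arc_of_label (hf : IsBaseLabelling M f) (hg : IsBaseLabelling M g) {i : Fin k}
    (hy : f y ≠ i) (hgy : g y = i) : ∃ x, f x = i ∧ g x ≠ i ∧ Arc M f x y := by
  by_contra! hc
  have hE : y ∈ (M i).E := (hg.isBase i).subset_ground hgy
  have h1 := mem_closure_inter hf (g := g) hy hE hc
  have hs : classes k f i ∩ classes k g i ⊆ classes k g i \ {y} :=
    fun z hz => ⟨hz.2, fun e => hy (e ▸ hz.1)⟩
  exact (hg.isBase i).indep.notMem_closure_sdiff_of_mem hgy ((M i).closure_subset_closure hs h1)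

/-- If `y` lies outside of both bases number `i`, and a differing element of the first basis can be
exchanged for `y`, then so can a differing element of the second. -/
theorem exists_arc_of_arc (hf : IsBaseLabelling M f) (hg : IsBaseLabelling M g) {i : Fin k}
    (hy : f y ≠ i) (hgy : g y ≠ i) (hx : f x = i) (hgx : g x ≠ i) (h : Arc M f x y) :
    ∃ z, g z = i ∧ f z ≠ i ∧ Arc M g z y := by
  by_contra! hc
  have h0 := (arc_iff hf hx hy).1 h
  have h1 := mem_closure_inter hg (g := f) hgy h0.1 hc
  have hs : classes k g i ∩ classes k f i ⊆ classes k f i \ {x} :=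
    fun z hz => ⟨hz.2, fun e => hgx (e ▸ hz.1)⟩
  exact h0.2 ((M i).closure_subset_closure hs h1)

theorem not_arc_of_not_arc (hf : IsBaseLabelling M f) (hg : IsBaseLabelling M g) (hy : f y = g y)
    (h : ∀ z, f z ≠ g z → ¬ Arc M f z y) (hx : f x ≠ g x) : ¬ Arc M g x y := by
  intro hA
  obtain ⟨i, hi⟩ : ∃ i : Fin k, g x = i := ⟨⟨g x, hA.lt⟩, rfl⟩
  have hgy : g y ≠ i := hi ▸ hA.1
  obtain ⟨z, hz, hgz, hz'⟩ := exists_arc_of_arc hg hf hgy (hy ▸ hgy) hi (hi ▸ hx) hA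
  exact h z (by rw [hz]; exact hgz.symm) hz'

theorem Arc.of_not_arc (hf : IsBaseLabelling M f) (hg : IsBaseLabelling M g) (hy : f y = g y)
    (h : ∀ z, f z ≠ g z → ¬ Arc M f z y) (hx : f x = g x) (hA : Arc M f x y) : Arc M g x y := by
  obtain ⟨i, hi⟩ : ∃ i : Fin k, f x = i := ⟨⟨f x, hA.lt⟩, rfl⟩
  have hfy : f y ≠ i := hi ▸ hA.1
  have h0 := (arc_iff hf hi hfy).1 hA
  rw [arc_iff hg (hx ▸ hi) (hy ▸ hfy)]
  refine ⟨h0.1, fun hc => h0.2 ?_⟩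
  -- `y` is spanned by `B' \ {x}` and by the common part, hence by the intersection of the two
  have hg' := fun z => not_arc_of_not_arc (x := z) hf hg hy h
  have h1 : y ∈ (M i).closure ((classes k f i ∩ classes k g i) \ {x}) := by
    refine mem_closure_of_forall_sdiff (hg.isBase i) (fun z hz => hz.1.2) h0.1 fun z hz => ?_
    by_cases hzx : z = x
    · rwa [hzx]
    · by_contra hcz
      have hfz : f z ≠ i := fun e => hz.2 ⟨⟨e, hz.1⟩, hzx⟩
      have hgz : g z = i := hz.1
      exact hg' z (fun e => hfz (e.trans hgz)) ((arc_iff hg hgz (hy ▸ hfy)).2 ⟨h0.1, hcz⟩)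
  exact (M i).closure_subset_closure (Set.sdiff_subset_sdiff_left Set.inter_subset_left) h1

theorem arc_iff_arc (hf : IsBaseLabelling M f) (hg : IsBaseLabelling M g) (hy : f y = g y)
    (h : ∀ z, f z ≠ g z → ¬ Arc M f z y) (hx : f x = g x) : Arc M f x y ↔ Arc M g x y :=
  ⟨fun hA => hA.of_not_arc hf hg hy h hx, fun hA => hA.of_not_arc hg hf hy.symm
    (fun _ hz => not_arc_of_not_arc hf hg hy h hz.symm) hx.symm⟩

/-! ### Shifting along a chordless path -/

/-- `p j` is free, `p L, …, p j` is a path of the exchange graph, and no arc of the exchange graph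
jumps forward along this path. The path is traversed from `p L` to `p j`, while the exchanges are
made in the order from `p j` to `p L`. -/
structure IsShiftPath (M : Fin k → Matroid (Fin n)) (f : Fin n → ℕ) (p : ℕ → Fin n)
    (j L : ℕ) : Prop where
  free : f (p j) = k
  arc : ∀ a, j ≤ a → a < L → Arc M f (p (a + 1)) (p a)
  chordless : ∀ a b, j ≤ a → a + 1 < b → b ≤ L → ¬ Arc M f (p b) (p a)

variable {p : ℕ → Fin n} {j L : ℕ}

theorem IsShiftPath.exchange (hf : IsBaseLabelling M f) (hp : IsShiftPath M f p j L)
    (hinj : ∀ a ≤ L, ∀ b ≤ L, p a = p b → a = b) (hj : j < L) :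
    IsShiftPath M (exchange k f (p (j + 1)) (p j)) p (j + 1) L := by
  have h0 := hp.arc j le_rfl hj
  have hne : ∀ a ≤ L, ∀ b ≤ L, a ≠ b → p a ≠ p b := fun a ha b hb h e => h (hinj a ha b hb e)
  have key : ∀ a b, j + 1 ≤ a → a < b → b ≤ L →
      (Arc M (_root_.exchange k f (p (j + 1)) (p j)) (p b) (p a) ↔ Arc M f (p b) (p a)) :=
    fun a b h1 h2 h3 => arc_exchange_iff hf h0 hp.free (hne _ h3 _ (by omega) (by omega))
      (hne _ h3 _ (by omega) (by omega)) (hne _ (by omega) _ (by omega) (by omega))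
      (hp.chordless j b le_rfl (by omega) h3)
  exact ⟨exchange_left h0.ne, fun a h1 h2 => (key a _ h1 (by omega) (by omega)).2
    (hp.arc a (by omega) h2), fun a b h1 h2 h3 h4 => hp.chordless a b (by omega) h2 h3
    ((key a b h1 (by omega) h3).1 h4)⟩

/-- `f'` is the labelling `f` after the first `j` exchanges along the path `p`. -/
structure IsShifted (k : ℕ) (f : Fin n → ℕ) (p : ℕ → Fin n) (j : ℕ) (f' : Fin n → ℕ) : Prop where
  shift : ∀ a < j, f' (p a) = f (p (a + 1))
  free : f' (p j) = k
  off : ∀ z, (∀ a ≤ j, p a ≠ z) → f' z = f z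

theorem IsShifted.exchange (hs : IsShifted k f p j h)
    (hinj : ∀ a ≤ L, ∀ b ≤ L, p a = p b → a = b) (hj : j < L) :
    IsShifted k f p (j + 1) (exchange k h (p (j + 1)) (p j)) := by
  have hne : ∀ a ≤ L, ∀ b ≤ L, a ≠ b → p a ≠ p b := fun a ha b hb h e => h (hinj a ha b hb e)
  have hnext : h (p (j + 1)) = f (p (j + 1)) :=
    hs.off _ fun a ha => hne _ (by omega) _ (by omega) (by omega)
  refine ⟨fun a ha => ?_, exchange_left (hne _ (by omega) _ (by omega) (by omega)), fun z hz => ?_⟩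
  · rcases Nat.lt_succ_iff_lt_or_eq.1 ha with ha' | rfl
    · rw [exchange_of_ne (hne _ (by omega) _ (by omega) (by omega))
        (hne _ (by omega) _ (by omega) (by omega)), hs.shift a ha']
    · rw [exchange_right, hnext]
  · rw [exchange_of_ne (hz _ le_rfl).symm (hz _ (by omega)).symm]
    exact hs.off z fun a ha => hz a (by omega)

/-! ### The measure of progress -/

/-- The number of elements of the bases described by `f` that `g` labels differently. -/
def discrepancy (k : ℕ) (f g : Fin n → ℕ) : ℕ :=
  (Finset.univ.filter fun z => f z ≠ k ∧ f z ≠ g z).card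

theorem discrepancy_le : discrepancy k f g ≤ n :=
  (Finset.card_le_univ _).trans (by simp)

theorem discrepancy_exchange_lt (hA : Arc M f x y) (hxy : f x = g y) (hx : f x ≠ g x) :
    discrepancy k (exchange k f x y) g < discrepancy k f g := by
  refine Finset.card_lt_card ?_
  rw [Finset.ssubset_iff_of_subset]
  · refine ⟨x, by simp [hA.lt.ne, hx], by simp [exchange_left hA.ne]⟩
  · intro z
    simp only [Finset.mem_filter, Finset.mem_univ, true_and]
    by_cases h1 : z = y
    · subst h1; simp [exchange_right, hxy]
    · by_cases h2 : z = x
      · subst h2; simp [exchange_left h1]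
      · rw [exchange_of_ne h2 h1]; exact id

/-- Shifting `f` along a path that starts in `p L`, and `g` along the path with `p L` replaced by
`x'`, brings the labellings closer: they agree on the new labels of the path, and `p L` is now free
in the first of them. -/
theorem discrepancy_shift_lt {f' g' : Fin n → ℕ} {x' : Fin n} {L : ℕ}
    (hD : f (p (L + 1)) ≠ g (p (L + 1))) (hlt : f (p (L + 1)) < k)
    (heq : ∀ a ≤ L, f (p a) = g (p a))
    (hinj : ∀ a ≤ L + 1, ∀ b ≤ L + 1, p a = p b → a = b)
    (hx' : g x' = f (p (L + 1))) (hfx' : f x' ≠ g x')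
    (hf' : IsShifted k f p (L + 1) f')
    (hg' : IsShifted k g (Function.update p (L + 1) x') (L + 1) g') :
    discrepancy k f' g' < discrepancy k f g := by
  have hup : ∀ a ≤ L, Function.update p (L + 1) x' a = p a := fun a ha => by
    rw [Function.update_of_ne (by omega)]
  have hagree : ∀ a ≤ L, f' (p a) = g' (p a) := by
    intro a ha
    have h1 := hf'.shift a (by omega)
    have h2 := hg'.shift a (by omega)
    rw [hup a ha] at h2
    rw [h1, h2]
    rcases ha.lt_or_eq with h | rfl
    · rw [hup _ h, heq _ h]
    · rw [Function.update_self, hx']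
  refine Finset.card_lt_card ?_
  rw [Finset.ssubset_iff_of_subset]
  · exact ⟨p (L + 1), by simp [hlt.ne, hD], by simp [hf'.free]⟩
  · intro z
    simp only [Finset.mem_filter, Finset.mem_univ, true_and]
    rintro ⟨h1, h2⟩
    have hz : ∀ a ≤ L + 1, p a ≠ z := by
      rintro a ha rfl
      rcases ha.lt_or_eq with h | rfl
      · exact h2 (hagree a (by omega))
      · exact h1 hf'.free
    rw [hf'.off z hz] at h1 h2
    refine ⟨h1, ?_⟩
    by_cases hzx : z = x'
    · rwa [hzx]
    · rwa [hg'.off z] at h2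
      intro a ha
      rcases ha.lt_or_eq with h | rfl
      · rw [hup a (by omega)]; exact hz a ha
      · rw [Function.update_self]; exact Ne.symm hzx

/-- The path of the second labelling: replace the first vertex `p (L + 1)` by an element `x'`. -/
theorem IsShiftPath.update (hf : IsBaseLabelling M f) (hg : IsBaseLabelling M g) {L : ℕ}
    {x' : Fin n} (hp : IsShiftPath M f p 0 (L + 1)) (heq : ∀ a ≤ L, f (p a) = g (p a))
    (hno : ∀ a < L, ∀ z, f z ≠ g z → ¬ Arc M f z (p a))
    (hfx' : f x' ≠ g x') (hA : Arc M g x' (p L)) :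
    IsShiftPath M g (Function.update p (L + 1) x') 0 (L + 1) := by
  have hup : ∀ a ≤ L, Function.update p (L + 1) x' a = p a := fun a ha => by
    rw [Function.update_of_ne (by omega)]
  refine ⟨?_, fun a _ ha => ?_, fun a b _ hab hb => ?_⟩
  · rw [hup 0 (by omega), ← heq 0 (by omega), hp.free]
  · rw [hup a (by omega)]
    rcases (Nat.lt_succ_iff.1 ha).lt_or_eq with h | rfl
    · rw [hup _ h, ← arc_iff_arc hf hg (heq a (by omega)) (hno a h) (heq _ h)]
      exact hp.arc a (by omega) ha
    · rwa [Function.update_self]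
  · rw [hup a (by omega)]
    have hn := hno a (by omega)
    rcases hb.lt_or_eq with h | rfl
    · rw [hup _ (by omega), ← arc_iff_arc hf hg (heq a (by omega)) hn (heq _ (by omega))]
      exact hp.chordless a b (by omega) hab hb
    · rw [Function.update_self]
      exact not_arc_of_not_arc hf hg (heq a (by omega)) hn hfx'

theorem injOn_update {L : ℕ} {x' : Fin n} (heq : ∀ a ≤ L, f (p a) = g (p a))
    (hinj : ∀ a ≤ L + 1, ∀ b ≤ L + 1, p a = p b → a = b) (hfx' : f x' ≠ g x') :
    ∀ a ≤ L + 1, ∀ b ≤ L + 1,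
      Function.update p (L + 1) x' a = Function.update p (L + 1) x' b → a = b := by
  have hup : ∀ a ≤ L, Function.update p (L + 1) x' a = p a := fun a ha => by
    rw [Function.update_of_ne (by omega)]
  intro a ha b hb h
  rcases ha.lt_or_eq with ha' | rfl <;> rcases hb.lt_or_eq with hb' | rfl
  · rw [hup a (by omega), hup b (by omega)] at h
    exact hinj a ha b hb h
  · rw [hup a (by omega), Function.update_self] at h
    exact (hfx' (h ▸ heq a (by omega))).elim
  · rw [hup b (by omega), Function.update_self] at h
    exact (hfx' (h ▸ heq b (by omega))).elim
  · rfl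

end ExchangeGraph

/-! ### Sequences of steps -/

section Steps

variable {n k : ℕ} {M : Fin k → Matroid (Fin n)} {f g : Fin n → ℕ} {x y : Fin n}

/-- A single step between two feasible basis sequences. -/
def Step (M : Fin k → Matroid (Fin n)) (S S' : Fin k → Set (Fin n)) : Prop :=
  Feasible M S ∧ Feasible M S' ∧ Adjacent M S S'

theorem Step.symm {S S' : Fin k → Set (Fin n)} (h : Step M S S') : Step M S' S := by
  obtain ⟨h1, h2, i, hj, x, hx, y, hy, hi⟩ := h
  have hxy : x ≠ y := fun e => hy.2 (e ▸ hx)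
  refine ⟨h2, h1, i, fun j hji => (hj j hji).symm, y, by simp [hi], x,
    ⟨(h1.1 i).subset_ground hx, by simp [hi, hxy]⟩, ?_⟩
  rw [hi]
  ext z
  simp only [Set.mem_insert_iff, Set.mem_sdiff, Set.mem_singleton_iff]
  by_cases hz : z = x
  · subst hz; simp [hx]
  · by_cases hz' : z = y
    · subst hz'; simp [hz, hy.2]
    · simp [hz, hz']

theorem Reconfigurable.reflTransGen {S S' : Fin k → Set (Fin n)} (h : Reconfigurable M S S') :
    Relation.ReflTransGen (Step M) S S' := by
  obtain ⟨ℓ, R, rfl, rfl, hF, hA⟩ := h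
  have : ∀ t ≤ ℓ, Relation.ReflTransGen (Step M) (R 0) (R t) := by
    intro t
    induction t with
    | zero => exact fun _ => .refl
    | succ t ih =>
      exact fun ht => (ih (by omega)).tail ⟨hF t (by omega), hF _ ht, hA t ht⟩
  exact this ℓ le_rfl

theorem reflTransGen_step_symm {S S' : Fin k → Set (Fin n)}
    (h : Relation.ReflTransGen (Step M) S S') : Relation.ReflTransGen (Step M) S' S := by
  induction h with
  | refl => exact .refl
  | tail _ h ih => exact .head h.symm ih

/-- A single step between two labellings. -/
def LabelStep (M : Fin k → Matroid (Fin n)) (f f' : Fin n → ℕ) : Prop :=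
  IsBaseLabelling M f ∧ IsBaseLabelling M f' ∧ Adjacent M (classes k f) (classes k f')

theorem LabelStep.step {f f' : Fin n → ℕ} (h : LabelStep M f f') :
    Step M (classes k f) (classes k f') :=
  ⟨h.1.feasible, h.2.1.feasible, h.2.2⟩

theorem labelStep_exchange (hf : IsBaseLabelling M f) (h : Arc M f x y) (hy : f y = k) :
    LabelStep M f (exchange k f x y) :=
  ⟨hf, hf.exchange h hy, adjacent_exchange hf h hy⟩

theorem reflTransGen_of_labelStep {F : ℕ → Fin n → ℕ} {a : ℕ}
    (hF : ∀ t < a, LabelStep M (F t) (F (t + 1))) :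
    Relation.ReflTransGen (Step M) (classes k (F 0)) (classes k (F a)) := by
  induction a with
  | zero => exact .refl
  | succ a ih => exact (ih fun t ht => hF t (by omega)).tail (hF a (by omega)).step

/-- Two sequences of steps that end in the same labelling, the first one followed by the reversed
second one. -/
theorem isReconfSeq_join {F G : ℕ → Fin n → ℕ} {a b : ℕ} (hF0 : IsBaseLabelling M (F 0))
    (hG0 : IsBaseLabelling M (G 0)) (hF : ∀ t < a, LabelStep M (F t) (F (t + 1)))
    (hG : ∀ t < b, LabelStep M (G t) (G (t + 1))) {H : ℕ → Fin n → ℕ}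
    (h1 : ∀ t ≤ a, H t = F t) (h2 : ∀ t ≤ b, H (a + b - t) = G t) :
    (∀ t ≤ a + b, IsBaseLabelling M (H t)) ∧
      IsReconfSeq M (classes k (F 0)) (classes k (G 0)) (a + b) (fun t => classes k (H t)) := by
  have gF : ∀ t ≤ a, IsBaseLabelling M (F t) := by
    rintro (_ | t) ht
    · exact hF0
    · exact (hF t (by omega)).2.1
  have gG : ∀ t ≤ b, IsBaseLabelling M (G t) := by
    rintro (_ | t) ht
    · exact hG0
    · exact (hG t (by omega)).2.1
  have gH : ∀ t ≤ a + b, IsBaseLabelling M (H t) := by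
    intro t ht
    by_cases hta : t ≤ a
    · rw [h1 t hta]; exact gF t hta
    · have := h2 (a + b - t) (by omega)
      rw [show a + b - (a + b - t) = t by omega] at this
      rw [this]; exact gG _ (by omega)
  refine ⟨gH, ?_, ?_, fun t ht => (gH t ht).feasible, fun t ht => ?_⟩
  · simp only; rw [h1 0 (by omega)]
  · simp only
    have := h2 0 (by omega)
    rw [Nat.sub_zero] at this
    rw [this]
  · by_cases hta : t < a
    · simp only
      rw [h1 t (by omega), h1 (t + 1) (by omega)]
      exact (hF t hta).2.2
    · obtain ⟨c, hc⟩ : ∃ c, a + b = t + 1 + c := ⟨a + b - (t + 1), by omega⟩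
      rw [hc] at h2
      have e1 := h2 c (by omega)
      have e2 := h2 (c + 1) (by omega)
      rw [show t + 1 + c - c = t + 1 by omega] at e1
      rw [show t + 1 + c - (c + 1) = t by omega] at e2
      simp only
      rw [e1, e2]
      exact (hG c (by omega)).step.symm.2.2

/-! ### Frozen elements -/

/-- If no arc leaves the set `A`, and `A` contains no free element, then no sequence of steps moves
an element of `A`. -/
theorem inter_eq_of_reflTransGen (hf : IsBaseLabelling M f) {A : Set (Fin n)}
    (hA : ∀ x ∈ A, ∀ y, Arc M f x y → y ∈ A) (hfree : ∀ x ∈ A, f x ≠ k)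
    {S : Fin k → Set (Fin n)} (hS : Relation.ReflTransGen (Step M) (classes k f) S) (i : Fin k) :
    S i ∩ A = classes k f i ∩ A := by
  -- the part of each basis outside of `A` spans all elements outside of `A`
  have hspan : ∀ i, ∀ y ∈ (M i).E, y ∉ A → y ∈ (M i).closure (classes k f i \ A) := by
    intro i y hE hyA
    by_cases hy : f y = i
    · exact (M i).mem_closure_of_mem' ⟨hy, hyA⟩ hE
    · refine mem_closure_of_forall_sdiff (hf.isBase i) Set.sdiff_subset hE fun z hz => ?_
      have hzA : z ∈ A := by
        by_contra h
        exact hz.2 ⟨hz.1, h⟩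
      by_contra hc
      exact hyA (hA z hzA y ((arc_iff hf hz.1 hy).2 ⟨hE, hc⟩))
  induction hS generalizing i with
  | refl => rfl
  | @tail R S _ hstep ih =>
    obtain ⟨hR, hS, j, hne, x, hx, y, hy, hj⟩ := hstep
    by_cases hij : i = j
    swap
    · rw [← hne i hij]; exact ih i
    subst hij
    have hyA : y ∉ A := by
      intro hyA
      have hlt : f y < k := lt_of_le_of_ne (hf.le y) (hfree y hyA)
      have hyj : y ∈ R ⟨f y, hlt⟩ := by
        have h : y ∈ classes k f ⟨f y, hlt⟩ ∩ A := ⟨rfl, hyA⟩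
        rw [← ih] at h
        exact h.1
      by_cases hji : (⟨f y, hlt⟩ : Fin k) = i
      · rw [hji] at hyj; exact hy.2 hyj
      · rw [hne _ hji] at hyj
        exact Set.disjoint_left.1 (hS.2 _ _ hji) hyj (by rw [hj]; simp)
    have hxA : x ∉ A := by
      intro hxA
      have hind : (M i).Indep (insert y (R i \ A)) := by
        refine (hS.1 i).indep.subset ?_
        rw [hj]
        exact Set.insert_subset_insert fun z hz => ⟨hz.1, fun e => hz.2 (e ▸ hxA)⟩
      have hsub : insert y (R i \ A) ⊆ (M i).closure (classes k f i \ A) := by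
        refine Set.insert_subset (hspan i y hy.1 hyA) fun z hz => ?_
        exact hspan i z ((hR.1 i).subset_ground hz.1) hz.2
      have hle := hind.encard_le_eRk_of_subset hsub
      rw [Matroid.eRk_closure_eq,
        ((hf.isBase i).indep.subset Set.sdiff_subset).eRk_eq_encard,
        Set.encard_insert_of_notMem (fun h => hy.2 h.1)] at hle
      have h1 := Set.encard_sdiff_add_encard_inter (R i) A
      have h2 := Set.encard_sdiff_add_encard_inter (classes k f i) A
      rw [ih, (hR.1 i).encard_eq_eRank] at h1
      rw [(hf.isBase i).encard_eq_eRank, ← h1] at h2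
      have h3 := WithTop.add_right_cancel (Set.toFinite _).encard_lt_top.ne h2
      rw [h3] at hle
      exact absurd hle (not_le.2 (ENat.lt_add_one_iff (Set.toFinite _).encard_lt_top.ne |>.2 le_rfl))
    rw [← ih i, hj]
    ext z
    simp only [Set.mem_inter_iff, Set.mem_insert_iff, Set.mem_sdiff, Set.mem_singleton_iff]
    constructor
    · rintro ⟨rfl | h, hz⟩
      · exact (hyA hz).elim
      · exact ⟨h.1, hz⟩
    · rintro ⟨h, hz⟩
      exact ⟨Or.inr ⟨h, fun e => hxA (e ▸ hz)⟩, hz⟩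

theorem not_reflTransGen_of_frozen (hf : IsBaseLabelling M f)
    {A : Set (Fin n)} (hA : ∀ x ∈ A, ∀ y, Arc M f x y → y ∈ A) (hfree : ∀ x ∈ A, f x ≠ k)
    (hx : x ∈ A) (hne : f x ≠ g x) :
    ¬ Relation.ReflTransGen (Step M) (classes k f) (classes k g) := by
  intro h
  have hlt : f x < k := lt_of_le_of_ne (hf.le x) (hfree x hx)
  have h1 := inter_eq_of_reflTransGen hf hA hfree h ⟨f x, hlt⟩
  have h2 : x ∈ classes k f ⟨f x, hlt⟩ ∩ A := ⟨rfl, hx⟩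
  rw [← h1] at h2
  exact hne h2.1.symm

/-! ### Breadth-first search -/

/-- The state of a search in the exchange graph of `f`. The queue is `q 0, …, q (tail - 1)`; its
first `d` entries are the elements on which `f` and `g` differ. All entries before `head` have been
processed, and `head` has been compared to the elements less than `i`. The entry `t ≥ d` was found
from the entry `ch t`, and from none before. -/
structure IsSearch (M : Fin k → Matroid (Fin n)) (f g : Fin n → ℕ) (q : ℕ → Fin n) (ch : ℕ → ℕ)
    (d tail head i : ℕ) : Prop where
  inj : ∀ t < tail, ∀ t' < tail, q t = q t' → t = t'
  le : d ≤ tail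
  seed : ∀ t < d, f (q t) ≠ g (q t)
  seeded : ∀ x, f x ≠ g x → ∃ t < d, q t = x
  lt : ∀ t, d ≤ t → t < tail → ch t < t
  arc : ∀ t, d ≤ t → t < tail → Arc M f (q (ch t)) (q t)
  first : ∀ t, d ≤ t → t < tail → ∀ s < ch t, ¬ Arc M f (q s) (q t)
  closed : ∀ x, (∀ t < tail, q t ≠ x) → ∀ t < head, ¬ Arc M f (q t) x
  partly : ∀ x : Fin n, (∀ t < tail, q t ≠ x) → (x : ℕ) < i → ¬ Arc M f (q head) x

variable {q : ℕ → Fin n} {ch : ℕ → ℕ} {d tail head i : ℕ}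

theorem le_of_injOn {m : ℕ} (h : ∀ t < m, ∀ t' < m, q t = q t' → t = t') : m ≤ n := by
  have := Finset.card_le_card_of_injOn (s := Finset.range m) (t := Finset.univ) q
    (fun _ _ => Finset.mem_univ _)
    (fun a ha b hb e => h a (by simpa using ha) b (by simpa using hb) e)
  simpa using this

theorem IsSearch.tail_le (h : IsSearch M f g q ch d tail head i) : tail ≤ n := le_of_injOn h.inj

theorem IsSearch.skip (h : IsSearch M f g q ch d tail head i) (hy : (y : ℕ) = i)
    (hs : (∃ t < tail, q t = y) ∨ ¬ Arc M f (q head) y) :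
    IsSearch M f g q ch d tail head (i + 1) where
  __ := h
  partly := by
    intro x hx hi
    rcases Nat.lt_succ_iff_lt_or_eq.1 hi with hi | hi
    · exact h.partly x hx hi
    · obtain rfl : x = y := Fin.ext (hi.trans hy.symm)
      rcases hs with ⟨t, ht, e⟩ | hs
      · exact (hx t ht e).elim
      · exact hs

theorem IsSearch.push (h : IsSearch M f g q ch d tail head i) (hy : (y : ℕ) = i)
    (hn : ∀ t < tail, q t ≠ y) (hA : Arc M f (q head) y) (ht : head < tail)
    {q' : ℕ → Fin n} {ch' : ℕ → ℕ} (hq : ∀ t < tail, q' t = q t) (hq' : q' tail = y)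
    (hch : ∀ t < tail, ch' t = ch t) (hch' : ch' tail = head) :
    IsSearch M f g q' ch' d (tail + 1) head (i + 1) := by
  have hle := h.le
  refine ⟨fun t h1 t' h2 e => ?_, by omega, fun t h1 => ?_, fun x hx => ?_, fun t h1 h2 => ?_,
    fun t h1 h2 => ?_, fun t h1 h2 s hs => ?_, fun x hx t h1 => ?_, fun x hx hi => ?_⟩
  · rcases Nat.lt_succ_iff_lt_or_eq.1 h1 with h1 | rfl <;>
      rcases Nat.lt_succ_iff_lt_or_eq.1 h2 with h2 | rfl
    · rw [hq t h1, hq t' h2] at e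
      exact h.inj t h1 t' h2 e
    · rw [hq t h1, hq'] at e
      exact (hn t h1 e).elim
    · rw [hq t' h2, hq'] at e
      exact (hn t' h2 e.symm).elim
    · rfl
  · rw [hq t (by omega)]; exact h.seed t h1
  · obtain ⟨t, h1, h2⟩ := h.seeded x hx
    exact ⟨t, h1, by rw [hq t (by omega), h2]⟩
  · rcases Nat.lt_succ_iff_lt_or_eq.1 h2 with h2 | rfl
    · rw [hch t h2]; exact h.lt t h1 h2
    · rwa [hch']
  · rcases Nat.lt_succ_iff_lt_or_eq.1 h2 with h2 | rfl
    · have := h.lt t h1 h2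
      rw [hch t h2, hq t h2, hq _ (by omega)]; exact h.arc t h1 h2
    · rwa [hch', hq', hq _ ht]
  · rcases Nat.lt_succ_iff_lt_or_eq.1 h2 with h2 | rfl
    · have := h.lt t h1 h2
      rw [hch t h2] at hs
      rw [hq t h2, hq _ (by omega)]; exact h.first t h1 h2 s hs
    · rw [hch'] at hs
      rw [hq', hq _ (by omega)]
      exact h.closed y hn s hs
  · rw [hq t (by omega)]
    exact h.closed x (fun t h2 => hq t h2 ▸ hx t (by omega)) t h1
  · rw [hq _ ht]
    have hx' : ∀ t < tail, q t ≠ x := fun t h2 => hq t h2 ▸ hx t (by omega)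
    refine h.partly x hx' (lt_of_le_of_ne (by omega) fun e => ?_)
    exact hx tail (by omega) (hq'.trans (Fin.ext (hy.trans e.symm)))

theorem IsSearch.next (h : IsSearch M f g q ch d tail head n) :
    IsSearch M f g q ch d tail (head + 1) 0 where
  __ := h
  closed := by
    intro x hx t ht
    rcases Nat.lt_succ_iff_lt_or_eq.1 ht with ht | rfl
    · exact h.closed x hx t ht
    · exact h.partly x hx x.2
  partly := fun x _ hx => (Nat.not_lt_zero _ hx).elim

theorem IsSearch.start (inj : ∀ t < d, ∀ t' < d, q t = q t' → t = t')
    (seed : ∀ t < d, f (q t) ≠ g (q t)) (seeded : ∀ x, f x ≠ g x → ∃ t < d, q t = x) :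
    IsSearch M f g q ch d d 0 0 :=
  ⟨inj, le_rfl, seed, seeded, by omega, by omega, by omega, by omega, by omega⟩

/-- A search that ends without reaching a free element proves that `g` cannot be reached. -/
theorem IsSearch.not_reflTransGen (h : IsSearch M f g q ch d tail tail 0) (hd : 0 < d)
    (hf : IsBaseLabelling M f) (hfree : ∀ t < tail, f (q t) ≠ k) :
    ¬ Relation.ReflTransGen (Step M) (classes k f) (classes k g) := by
  refine not_reflTransGen_of_frozen hf (A := {x | ∃ t < tail, q t = x}) ?_ ?_
    (x := q 0) ⟨0, hd.trans_le h.le, rfl⟩ (h.seed 0 hd)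
  · rintro _ ⟨t, ht, rfl⟩ y hA
    by_contra hc
    exact h.closed y (fun s hs e => hc ⟨s, hs, e⟩) t ht hA
  · rintro _ ⟨t, ht, rfl⟩
    exact hfree t ht

/-- The path that is obtained by following the search tree from a free entry `t₀` of the queue to
one of the first `d` entries: it has no chords, and no differing element except for its first one
has an arc to the part of the path beyond the second vertex. -/
theorem IsSearch.path (h : IsSearch M f g q ch d tail head i) {t₀ L : ℕ} (ht₀ : t₀ < tail)
    (hfree : f (q t₀) = k) (hL : ∀ a ≤ L, d ≤ ch^[a] t₀) (hL' : ch^[L + 1] t₀ < d) {p : ℕ → Fin n}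
    (hp : ∀ a ≤ L + 1, p a = q (ch^[a] t₀)) :
    IsShiftPath M f p 0 (L + 1) ∧ (∀ a ≤ L + 1, ∀ b ≤ L + 1, p a = p b → a = b) ∧
      (∀ a ≤ L, f (p a) = g (p a)) ∧ (∀ a < L, ∀ z, f z ≠ g z → ¬ Arc M f z (p a)) ∧
      f (p (L + 1)) ≠ g (p (L + 1)) := by
  have hs : ∀ a, ch^[a + 1] t₀ = ch (ch^[a] t₀) := fun a => Function.iterate_succ_apply' ch a t₀
  have hlt : ∀ a ≤ L + 1, ch^[a] t₀ < tail := by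
    intro a
    induction a with
    | zero => exact fun _ => ht₀
    | succ a ih =>
      intro ha
      have := h.lt _ (hL a (by omega)) (ih (by omega))
      rw [hs]
      exact this.trans (ih (by omega))
  have hdec : ∀ a b, a < b → b ≤ L + 1 → ch^[b] t₀ < ch^[a] t₀ := by
    intro a b hab
    induction b, hab using Nat.le_induction with
    | base =>
      intro hb
      rw [hs]
      exact h.lt _ (hL a (by omega)) (hlt a (by omega))
    | succ b hab ih =>
      intro hb
      have h1 := ih (by omega)
      have h2 := h.lt _ (hL b (by omega)) (hlt b (by omega))
      rw [hs]
      exact h2.trans h1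
  refine ⟨⟨?_, fun a _ ha => ?_, fun a b _ hab hb => ?_⟩, fun a ha b hb e => ?_, fun a ha => ?_,
    fun a ha z hz => ?_, ?_⟩
  · rw [hp 0 (by omega)]; exact hfree
  · rw [hp a (by omega), hp (a + 1) (by omega), hs]
    exact h.arc _ (hL a (by omega)) (hlt a (by omega))
  · rw [hp a (by omega), hp b hb]
    refine h.first _ (hL a (by omega)) (hlt a (by omega)) _ ?_
    rw [← hs]
    exact hdec _ _ hab hb
  · rw [hp a ha, hp b hb] at e
    have h1 := h.inj _ (hlt a ha) _ (hlt b hb) e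
    rcases lt_trichotomy a b with hab | hab | hab
    · have := hdec a b hab hb; omega
    · exact hab
    · have := hdec b a hab ha; omega
  · by_contra hc
    obtain ⟨t, ht, e⟩ := h.seeded _ hc
    rw [hp a (by omega)] at e
    have h1 := h.inj _ (ht.trans_le h.le) _ (hlt a (by omega)) e
    have h2 := hL a ha
    omega
  · obtain ⟨t, ht, rfl⟩ := h.seeded _ hz
    rw [hp a (by omega)]
    refine h.first _ (hL a (by omega)) (hlt a (by omega)) _ ?_
    rw [← hs]
    exact ht.trans_le (hL (a + 1) (by omega))
  · rw [hp _ le_rfl]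
    exact h.seed _ hL'

end Steps

/-! ### The encoding by labels -/

section Label

variable {n k : ℕ} {M : Fin k → Matroid (Fin n)} {B : Fin k → Set (Fin n)}

theorem label_eq_iff (hB : ∀ i j, i ≠ j → Disjoint (B i) (B j)) (x : Fin n) (i : Fin k) :
    label B x = i ↔ x ∈ B i := by
  unfold label
  have := i.2
  constructor
  · intro h
    split at h
    · rename_i h'
      obtain ⟨_, h2⟩ := h'.choose_spec
      rwa [Fin.ext h] at h2
    · omega
  · intro h
    have h' : ∃ i : Fin k, ∃ hx : (x : ℕ) < n, (⟨x, hx⟩ : Fin n) ∈ B i := ⟨i, x.2, h⟩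
    rw [dif_pos h']
    obtain ⟨_, h2⟩ := h'.choose_spec
    by_contra hne
    exact Set.disjoint_left.1 (hB _ _ fun e => hne (congrArg Fin.val e)) h2 h

theorem label_le (x : ℕ) : label B x ≤ k := by
  unfold label
  split
  · exact Fin.is_le'
  · exact le_rfl

theorem classes_label (hB : Feasible M B) : classes k (fun x : Fin n => label B x) = B := by
  ext i x
  exact label_eq_iff hB.2 x i

theorem isBaseLabelling_label (hB : Feasible M B) :
    IsBaseLabelling M (fun x : Fin n => label B x) :=
  ⟨fun x => label_le x, fun i => by rw [classes_label hB]; exact hB.1 i⟩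

theorem label_classes {f : Fin n → ℕ} (hf : ∀ x, f x ≤ k) (x : Fin n) :
    label (classes k f) x = f x := by
  have hd : ∀ i j : Fin k, i ≠ j → Disjoint (classes k f i) (classes k f j) := fun i j hij =>
    Set.disjoint_left.2 fun z hi hj => hij (Fin.ext (hi.symm.trans hj))
  rcases (hf x).lt_or_eq with h | h
  · exact (label_eq_iff hd x ⟨f x, h⟩).2 rfl
  · refine ((label_le (B := classes k f) x).lt_or_eq.resolve_left fun h' => ?_).trans h.symm
    have := (label_eq_iff hd x ⟨_, h'⟩).1 rfl
    rw [mem_classes] at this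
    simp only at this
    omega

end Label

/-! ### Reasoning about programs -/

theorem Exec.calls_le_steps {O : ℕ → Set ℕ → Prop} {p : Prog} {s s' : Store} {T Q : ℕ}
    (h : Exec O p s s' T Q) : Q ≤ T := by
  induction h <;> omega

/-- The registers that a program may write to. -/
def Prog.regs : Prog → List ℕ
  | .skip => []
  | .set r _ => [r]
  | .put _ _ _ _ => []
  | .ask r _ _ _ => [r]
  | .seq p q => p.regs ++ q.regs
  | .ite _ p q => p.regs ++ q.regs
  | .loop _ p => p.regs

/-- The arrays that a program may write to. -/
def Prog.arrs : Prog → List ℕ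
  | .skip => []
  | .set _ _ => []
  | .put a _ _ _ => [a]
  | .ask _ _ _ _ => []
  | .seq p q => p.arrs ++ q.arrs
  | .ite _ p q => p.arrs ++ q.arrs
  | .loop _ p => p.arrs

/-- A bound for the number of steps of a program all of whose loops make fewer than `N`
iterations. -/
def Prog.bound (N : ℕ) : Prog → ℕ
  | .skip => 1
  | .set _ e => e.cost + 1
  | .put _ e₁ e₂ e => e₁.cost + e₂.cost + e.cost + 1
  | .ask _ e _ e' => e.cost + e'.cost + 1
  | .seq p q => p.bound N + q.bound N
  | .ite b p q => b.cost + (p.bound N + q.bound N)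
  | .loop b p => N * (b.cost + p.bound N)

/-- The depth of the nesting of loops. -/
def Prog.depth : Prog → ℕ
  | .skip => 0
  | .set _ _ => 0
  | .put _ _ _ _ => 0
  | .ask _ _ _ _ => 0
  | .seq p q => max p.depth q.depth
  | .ite _ p q => max p.depth q.depth
  | .loop _ p => p.depth + 1

/-- The bound is a polynomial whose degree is the depth of the nesting of loops. -/
theorem Prog.bound_le (p : Prog) {N : ℕ} (hN : 1 ≤ N) : p.bound N ≤ p.bound 1 * N ^ p.depth := by
  induction p with
  | skip => simp [bound, depth]
  | set r e => simp [bound, depth]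
  | put a e₁ e₂ e => simp [bound, depth]
  | ask r e a e' => simp [bound, depth]
  | seq p q hp hq =>
    simp only [bound, depth, add_mul]
    gcongr
    · exact hp.trans (by gcongr; exact le_max_left _ _)
    · exact hq.trans (by gcongr; exact le_max_right _ _)
  | ite b p q hp hq =>
    simp only [bound, depth, add_mul]
    gcongr
    · exact Nat.le_mul_of_pos_right _ (by positivity)
    · exact hp.trans (by gcongr; exact le_max_left _ _)
    · exact hq.trans (by gcongr; exact le_max_right _ _)
  | loop b p hp =>
    simp only [bound, depth, one_mul, pow_succ]
    calc N * (b.cost + p.bound N)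
        ≤ N * (b.cost * N ^ p.depth + p.bound 1 * N ^ p.depth) := by
          gcongr
          exact Nat.le_mul_of_pos_right _ (by positivity)
      _ = _ := by ring

/-- The memories `s` and `s'` agree on all that the program `p` does not write to. -/
def Agree (p : Prog) (s s' : Store) : Prop :=
  (∀ r, r ∉ p.regs → s'.reg r = s.reg r) ∧ ∀ a, a ∉ p.arrs → s'.arr a = s.arr a

theorem Agree.refl {p : Prog} {s : Store} : Agree p s s := ⟨fun _ _ => rfl, fun _ _ => rfl⟩

theorem Agree.trans {p : Prog} {s₁ s₂ s₃ : Store} (h : Agree p s₁ s₂) (h' : Agree p s₂ s₃) :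
    Agree p s₁ s₃ :=
  ⟨fun r hr => (h'.1 r hr).trans (h.1 r hr), fun a ha => (h'.2 a ha).trans (h.2 a ha)⟩

theorem Agree.mono {p q : Prog} {s s' : Store} (h : Agree p s s') (h1 : p.regs ⊆ q.regs)
    (h2 : p.arrs ⊆ q.arrs) : Agree q s s' :=
  ⟨fun r hr => h.1 r fun h => hr (h1 h), fun a ha => h.2 a fun h => ha (h2 h)⟩

theorem Exec.agree {O : ℕ → Set ℕ → Prop} {p : Prog} {s s' : Store} {T Q : ℕ}
    (h : Exec O p s s' T Q) : Agree p s s' := by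
  induction h with
  | skip s => exact .refl
  | set s r e =>
    refine ⟨fun r' hr => ?_, fun _ _ => rfl⟩
    simp only [Prog.regs, List.mem_singleton] at hr
    simp [Store.setReg, hr]
  | put s a e₁ e₂ e =>
    refine ⟨fun _ _ => rfl, fun a' ha => ?_⟩
    simp only [Prog.arrs, List.mem_singleton] at ha
    simp [Store.setArr, ha]
  | ask_yes s r e a e' h =>
    refine ⟨fun r' hr => ?_, fun _ _ => rfl⟩
    simp only [Prog.regs, List.mem_singleton] at hr
    simp [Store.setReg, hr]
  | ask_no s r e a e' h =>
    refine ⟨fun r' hr => ?_, fun _ _ => rfl⟩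
    simp only [Prog.regs, List.mem_singleton] at hr
    simp [Store.setReg, hr]
  | seq _ _ ih₁ ih₂ =>
    exact (ih₁.mono (List.subset_append_left _ _) (List.subset_append_left _ _)).trans
      (ih₂.mono (List.subset_append_right _ _) (List.subset_append_right _ _))
  | ite_true _ _ ih =>
    exact ih.mono (List.subset_append_left _ _) (List.subset_append_left _ _)
  | ite_false _ _ ih =>
    exact ih.mono (List.subset_append_right _ _) (List.subset_append_right _ _)
  | loop_true _ _ _ ih₁ ih₂ => exact Agree.trans ih₁ ih₂
  | loop_false _ => exact .refl

/-- Total correctness with a time bound: started in `s`, the program `p` halts after at most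
`p.bound N` steps in a memory that satisfies `P`. -/
def Runs (O : ℕ → Set ℕ → Prop) (N : ℕ) (p : Prog) (s : Store) (P : Store → Prop) : Prop :=
  ∃ s' T Q, Exec O p s s' T Q ∧ T ≤ p.bound N ∧ P s'

namespace Runs

variable {O : ℕ → Set ℕ → Prop} {N : ℕ} {p q : Prog} {s : Store} {P R : Store → Prop}

theorem imp (h : Runs O N p s P) (hP : ∀ s', Agree p s s' → P s' → R s') : Runs O N p s R := by
  obtain ⟨s', T, Q, h1, h2, h3⟩ := h
  exact ⟨s', T, Q, h1, h2, hP s' h1.agree h3⟩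

theorem skip (h : P s) : Runs O N .skip s P := ⟨s, _, _, .skip s, le_rfl, h⟩

theorem set {r : ℕ} {e : Expr} (h : P (s.setReg r (e.val s))) : Runs O N (.set r e) s P :=
  ⟨_, _, _, .set s r e, le_rfl, h⟩

theorem put {a : ℕ} {e₁ e₂ e : Expr} (h : P (s.setArr a (e₁.val s) (e₂.val s) (e.val s))) :
    Runs O N (.put a e₁ e₂ e) s P :=
  ⟨_, _, _, .put s a e₁ e₂ e, le_rfl, h⟩

theorem ask {r a : ℕ} {e e' : Expr}
    (h : ∀ v, (v = 1 ↔ O (e.val s) {x | s.arr a (e'.val s) x ≠ 0}) → P (s.setReg r v)) :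
    Runs O N (.ask r e a e') s P := by
  by_cases hO : O (e.val s) {x | s.arr a (e'.val s) x ≠ 0}
  · exact ⟨_, _, _, .ask_yes s r e a e' hO, le_rfl, h 1 (by simp [hO])⟩
  · exact ⟨_, _, _, .ask_no s r e a e' hO, le_rfl, h 0 (by simp [hO])⟩

theorem seq (h : Runs O N p s fun s' => Runs O N q s' P) : Runs O N (.seq p q) s P := by
  obtain ⟨s', T, Q, h1, h2, s'', T', Q', h3, h4, h5⟩ := h
  exact ⟨s'', _, _, .seq h1 h3, Nat.add_le_add h2 h4, h5⟩

theorem ite {b : Test} (h₁ : b.holds s → Runs O N p s P) (h₂ : ¬ b.holds s → Runs O N q s P) :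
    Runs O N (.ite b p q) s P := by
  by_cases hb : b.holds s
  · obtain ⟨s', T, Q, h1, h2, h3⟩ := h₁ hb
    exact ⟨s', _, _, .ite_true hb h1, by simp only [Prog.bound]; omega, h3⟩
  · obtain ⟨s', T, Q, h1, h2, h3⟩ := h₂ hb
    exact ⟨s', _, _, .ite_false hb h1, by simp only [Prog.bound]; omega, h3⟩

/-- The rule for loops, with an invariant `I` and a variant `V`; the number of iterations is bounded
by the initial value of the variant. -/
theorem loop_exec {b : Test} (I : Store → Prop) (V : Store → ℕ)
    (hb : ∀ t, Agree p s t → I t → b.holds t → Runs O N p t fun t' => I t' ∧ V t' < V t) :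
    ∀ m t, Agree p s t → I t → V t ≤ m → ∃ s' T Q, Exec O (.loop b p) t s' T Q ∧
      T ≤ (m + 1) * (b.cost + p.bound N) ∧ I s' ∧ ¬ b.holds s' := by
  intro m
  induction m with
  | zero =>
    intro t ht hI hV
    by_cases h : b.holds t
    · obtain ⟨s', T, Q, -, -, -, h4⟩ := hb t ht hI h
      omega
    · exact ⟨t, _, _, .loop_false h, by omega, hI, h⟩
  | succ m ih =>
    intro t ht hI hV
    by_cases h : b.holds t
    · obtain ⟨t', T, Q, h1, h2, h3, h4⟩ := hb t ht hI h
      obtain ⟨s', T', Q', h5, h6, h7⟩ := ih t' (ht.trans h1.agree) h3 (by omega)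
      exact ⟨s', _, _, .loop_true h h1 h5, by rw [add_mul _ 1]; omega, h7⟩
    · refine ⟨t, _, _, .loop_false h, ?_, hI, h⟩
      rw [add_mul _ 1]
      omega

theorem loop {b : Test} (I : Store → Prop) (V : Store → ℕ) (hI : I s) (hV : V s < N)
    (hb : ∀ t, Agree p s t → I t → b.holds t → Runs O N p t fun t' => I t' ∧ V t' < V t)
    (hP : ∀ t, Agree p s t → I t → ¬ b.holds t → P t) : Runs O N (.loop b p) s P := by
  obtain ⟨s', T, Q, h1, h2, h3, h4⟩ := loop_exec I V hb (V s) s .refl hI le_rfl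
  exact ⟨s', T, Q, h1, h2.trans (Nat.mul_le_mul_right _ hV), hP s' h1.agree h3 h4⟩

end Runs

/-- `for r := 0, …, (the value of register b) - 1 do p`. -/
def Prog.for (r b : ℕ) (p : Prog) : Prog :=
  .seq (.set r (.lit 0)) (.loop (.lt (.reg r) (.reg b)) (.seq p (.set r (.succ (.reg r)))))

theorem Runs.for {O : ℕ → Set ℕ → Prop} {N : ℕ} {p : Prog} {s : Store} {P : Store → Prop}
    {r b m : ℕ} (I : ℕ → Store → Prop) (hm : s.reg b = m) (hmN : m < N) (hr : r ∉ p.regs)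
    (hb : b ∉ (p.for r b).regs) (hI : I 0 (s.setReg r 0))
    (hp : ∀ i < m, ∀ t, Agree (p.for r b) s t → t.reg r = i → I i t →
      Runs O N p t fun t' => I (i + 1) (t'.setReg r (i + 1)))
    (hP : ∀ t, Agree (p.for r b) s t → I m t → P t) : Runs O N (p.for r b) s P := by
  have key : Runs O N (p.for r b) s fun t => I m t := by
    refine .seq (.set ?_)
    have h0 : Agree (p.for r b) s (s.setReg r 0) := by
      refine ⟨fun r' h => ?_, fun _ _ => rfl⟩
      have : r' ≠ r := by rintro rfl; exact h (by simp [Prog.for, Prog.regs])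
      simp [Store.setReg, this]
    have hsub : ∀ {t}, Agree (p.seq (.set r (.succ (.reg r)))) (s.setReg r 0) t →
        Agree (p.for r b) s t := fun h => h0.trans (h.mono
          (by simp [Prog.for, Prog.regs]) (by simp [Prog.for, Prog.arrs]))
    refine Runs.loop (fun t => t.reg r ≤ m ∧ I (t.reg r) t) (fun t => m - t.reg r) ?_ ?_ ?_ ?_
    · simpa [Store.setReg, Expr.val] using hI
    · exact (Nat.sub_le _ _).trans_lt hmN
    · rintro t ht ⟨h1, h2⟩ h3
      have hbt : t.reg b = m := ((hsub ht).1 b hb).trans hm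
      simp only [Test.holds, Expr.val, hbt] at h3
      refine .seq ((hp _ h3 t (hsub ht) rfl h2).imp fun t' ha h4 => .set ?_)
      have h5 : t'.reg r = t.reg r := ha.1 r hr
      simp only [Expr.val, h5]
      refine ⟨⟨?_, ?_⟩, ?_⟩
      · simp [Store.setReg]; omega
      · simpa [Store.setReg] using h4
      · simp [Store.setReg]; omega
    · rintro t ht ⟨h1, h2⟩ h3
      have hbt : t.reg b = m := ((hsub ht).1 b hb).trans hm
      simp only [Test.holds, Expr.val, hbt, not_lt] at h3
      rwa [le_antisymm h1 h3] at h2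
  exact key.imp hP

/-! ### The two sides of the memory

Registers: `0` and `1` contain `n` and `k`, `2` and `3` are loop counters, `4` is the answer of the
oracle, `5` the status (`0` while running), `6` and `7` the lengths of the two sequences, `8` and
`9` the elements `y` and `x` of an exchange of `x` for `y`, `10` a label, `11` and `12` the length
and the head of the queue, `13` the number of differing elements, `14` an index in the queue, `15`
the length of a path, `16` the replacement for its first vertex.

Arrays: `1` and `2` contain the current labellings, `3` and `4` the sequences, `5` and `6` the
characteristic vectors, `7` the queue, `8` the search tree, `9` the marks of the visited elements,
`10` a path, `11` the predecessor function. -/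

section Sides

variable {n k : ℕ}

/-- The first `n` cells of row `i` of the array `a`, as a labelling. -/
def Store.row (s : Store) (n a i : ℕ) : Fin n → ℕ := fun x => s.arr a i x

theorem Store.row_congr {s s' : Store} {a : ℕ} (h : s'.arr a = s.arr a) (n i : ℕ) :
    s'.row n a i = s.row n a i := by
  funext x
  simp [Store.row, h]

/-- Side `σ ∈ {1, 2}` of the memory keeps a sequence of labellings. The array `σ` contains the
current labelling in row `0`, the array `σ + 4` contains the characteristic vectors of its classes,
the array `σ + 2` contains all labellings so far, and the register `σ + 5` contains the number of
steps so far. -/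
structure IsSide (M : Fin k → Matroid (Fin n)) (f₀ : Fin n → ℕ) (σ : ℕ) (s : Store) : Prop where
  valid : IsBaseLabelling M (s.row n σ 0)
  table : ∀ c (x : Fin n), s.arr (σ + 4) c x = if s.arr σ 0 x = c then 1 else 0
  first : s.row n (σ + 2) 0 = f₀
  last : s.row n (σ + 2) (s.reg (σ + 5)) = s.row n σ 0
  steps : ∀ t < s.reg (σ + 5), LabelStep M (s.row n (σ + 2) t) (s.row n (σ + 2) (t + 1))

variable {M : Fin k → Matroid (Fin n)} {f₀ : Fin n → ℕ} {σ : ℕ} {s s' : Store} {N : ℕ}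
  {P : Store → Prop}

theorem IsSide.congr (h : IsSide M f₀ σ s) (h1 : s'.arr σ = s.arr σ)
    (h2 : s'.arr (σ + 2) = s.arr (σ + 2)) (h3 : s'.arr (σ + 4) = s.arr (σ + 4))
    (h4 : s'.reg (σ + 5) = s.reg (σ + 5)) : IsSide M f₀ σ s' := by
  refine ⟨?_, ?_, ?_, ?_, ?_⟩
  · rw [Store.row_congr h1]; exact h.valid
  · rw [h1, h3]; exact h.table
  · rw [Store.row_congr h2]; exact h.first
  · rw [Store.row_congr h1, Store.row_congr h2, h4]; exact h.last
  · intro t ht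
    rw [Store.row_congr h2, Store.row_congr h2]
    exact h.steps t (h4 ▸ ht)

/-- The entry of row `0` of the array `a` at `e`. -/
abbrev Expr.cell (a : ℕ) (e : Expr) : Expr := .get a (.lit 0) e

/-- Ask whether the element in register `x` can be exchanged for the one in register `y`, with
respect to the current labelling of side `σ`. The answer is stored in register `4`; the table of
characteristic vectors is changed for the question, and restored afterwards. -/
def Prog.query (σ x y : ℕ) : Prog :=
  .seq (.put (σ + 4) (.cell σ (.reg x)) (.reg x) (.lit 0)) <|
  .seq (.put (σ + 4) (.cell σ (.reg x)) (.reg y) (.lit 1)) <|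
  .seq (.ask 4 (.cell σ (.reg x)) (σ + 4) (.cell σ (.reg x))) <|
  .seq (.put (σ + 4) (.cell σ (.reg x)) (.reg x) (.lit 1)) <|
  .put (σ + 4) (.cell σ (.reg x)) (.reg y) (.lit 0)

theorem Runs.query {rx ry : ℕ} {x y : Fin n} (h : IsSide M f₀ σ s) (hx : s.reg rx = x)
    (hy : s.reg ry = y) (hxy : s.row n σ 0 y ≠ s.row n σ 0 x) (hrx : rx ≠ 4) (hry : ry ≠ 4)
    (hP : ∀ v, (v = 1 ↔ Arc M (s.row n σ 0) x y) → P (s.setReg 4 v)) :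
    Runs (basisOracle M) N (Prog.query σ rx ry) s P := by
  have hne : x ≠ y := fun e => hxy (e ▸ rfl)
  have hne' : (x : ℕ) ≠ y := fun e => hne (Fin.ext e)
  have hxy' : s.arr σ 0 y ≠ s.arr σ 0 x := hxy
  refine .seq (.put (.seq (.put (.seq (.ask fun v hv => ?_)))))
  refine .seq (.put (.put ?_))
  simp only [Store.setArr, Store.setReg, Expr.val, hx, hy, Function.update_of_ne hrx,
    Function.update_of_ne hry, show σ ≠ σ + 4 by omega, false_and, if_false, true_and] at hv ⊢
  have key : v = 1 ↔ Arc M (s.row n σ 0) x y := by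
    rw [hv]
    unfold Arc basisOracle
    simp only [ne_eq, hxy, not_false_iff, true_and]
    refine exists_congr fun hlt => ?_
    have : {z : Fin n | (z : ℕ) ∈ {x_1 : ℕ | (if x_1 = ↑y then 1 else if x_1 = ↑x then 0
        else s.arr (σ + 4) (s.arr σ 0 x) x_1) ≠ 0}} =
        insert y (classes k (s.row n σ 0) ⟨s.row n σ 0 x, hlt⟩ \ {x}) := by
      ext z
      simp only [Set.mem_ofPred_eq, Set.mem_insert_iff, Set.mem_sdiff, Set.mem_singleton_iff,
        mem_classes, h.table, Fin.val_inj, Store.row]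
      by_cases h1 : z = y
      · simp [h1]
      · by_cases h2 : z = x
        · simp [h2, hne]
        · simp [h1, h2]
    exact Eq.to_iff (congrArg _ this)
  convert hP v key using 1
  simp only [Store.setReg]
  congr 1
  funext a i j
  have t1 := h.table (s.arr σ 0 x) x
  have t2 := h.table (s.arr σ 0 x) y
  rw [if_pos rfl] at t1
  rw [if_neg hxy'] at t2
  split_ifs with h1 h2
  · rw [h1.1, h1.2.1, h1.2.2, t2]
  · rw [h2.1, h2.2.1, h2.2.2, t1]
  · rfl

/-- Append the current labelling of side `σ` to its sequence. -/
def Prog.record (σ : ℕ) : Prog :=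
  .for 2 0 (.put (σ + 2) (.reg (σ + 5)) (.reg 2) (.cell σ (.reg 2)))

theorem Runs.record {O : ℕ → Set ℕ → Prop} (hn : s.reg 0 = n) (hN : n < N) :
    Runs O N (Prog.record σ) s fun t => t.row n (σ + 2) (s.reg (σ + 5)) = s.row n σ 0 ∧
      ∀ i ≠ s.reg (σ + 5), t.arr (σ + 2) i = s.arr (σ + 2) i := by
  refine Runs.for (m := n) (fun j t => (∀ x : Fin n, (x : ℕ) < j →
      t.arr (σ + 2) (s.reg (σ + 5)) x = s.arr σ 0 x) ∧
      ∀ i ≠ s.reg (σ + 5), t.arr (σ + 2) i = s.arr (σ + 2) i) hn hN (by simp [Prog.regs])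
    (by simp [Prog.for, Prog.regs]) ⟨by simp, fun _ _ => rfl⟩ ?_ ?_
  · rintro j hj t ht hr ⟨h1, h2⟩
    have e1 : t.reg (σ + 5) = s.reg (σ + 5) := ht.1 _ (by simp [Prog.for, Prog.regs])
    have e2 : t.arr σ = s.arr σ := ht.2 _ (by simp [Prog.for, Prog.arrs])
    refine .put ⟨fun x hx => ?_, fun i hi => ?_⟩
    · simp only [Store.setReg, Store.setArr, Expr.val, e1, e2, hr, true_and]
      split
      · rename_i e; rw [e]
      · exact h1 x (by omega)
    · simp only [Store.setReg, Store.setArr, Expr.val, e1, e2, hr, true_and]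
      rw [← h2 i hi]
      funext j'
      simp [hi]
  · rintro t - ⟨h1, h2⟩
    exact ⟨funext fun x => h1 x x.2, h2⟩

/-- Exchange the element in register `9` for the free element in register `8` on side `σ`, and
append the resulting labelling to the sequence. -/
def Prog.exchange (σ : ℕ) : Prog :=
  .seq (.set 10 (.cell σ (.reg 9))) <|
  .seq (.put (σ + 4) (.reg 10) (.reg 9) (.lit 0)) <|
  .seq (.put (σ + 4) (.reg 1) (.reg 9) (.lit 1)) <|
  .seq (.put (σ + 4) (.reg 1) (.reg 8) (.lit 0)) <|
  .seq (.put (σ + 4) (.reg 10) (.reg 8) (.lit 1)) <|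
  .seq (.put σ (.lit 0) (.reg 9) (.reg 1)) <|
  .seq (.put σ (.lit 0) (.reg 8) (.reg 10)) <|
  .seq (.set (σ + 5) (.succ (.reg (σ + 5)))) <|
  .record σ

theorem Runs.exchange {O : ℕ → Set ℕ → Prop} {x y : Fin n} (hσ : σ = 1 ∨ σ = 2)
    (h : IsSide M f₀ σ s) (hn : s.reg 0 = n) (hN : n < N) (hk : s.reg 1 = k) (hx : s.reg 9 = x)
    (hy : s.reg 8 = y) (hA : Arc M (s.row n σ 0) x y) (hfree : s.row n σ 0 y = k) :
    Runs O N (Prog.exchange σ) s fun t => IsSide M f₀ σ t ∧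
      t.row n σ 0 = exchange k (s.row n σ 0) x y ∧ t.reg (σ + 5) = s.reg (σ + 5) + 1 := by
  have hne := hA.ne
  have hlt := hA.lt
  have hne' : (x : ℕ) ≠ y := fun e => hne (Fin.ext e)
  have hσ5 : σ + 5 = 6 ∨ σ + 5 = 7 := by omega
  refine .seq (.set (.seq (.put (.seq (.put (.seq (.put (.seq (.put (.seq (.put (.seq (.put
    (.seq (.set ?_)))))))))))))))
  generalize hs' : Store.setReg _ (σ + 5) _ = s'
  have r0 : s'.reg 0 = n := by
    rw [← hs']; simp [Store.setReg, Store.setArr, hn]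
  have r5 : s'.reg (σ + 5) = s.reg (σ + 5) + 1 := by
    rw [← hs']
    simp [Store.setReg, Store.setArr, Expr.val, Function.update_of_ne (show σ + 5 ≠ 10 by omega)]
  have a2 : s'.arr (σ + 2) = s.arr (σ + 2) := by
    rw [← hs']; simp [Store.setReg, Store.setArr, Expr.val]
  have a0 : s'.row n σ 0 = _root_.exchange k (s.row n σ 0) x y := by
    rw [← hs']
    funext z
    simp [Store.row, Store.setReg, Store.setArr, Expr.val, hx, hy, hk, Fin.val_inj,
      _root_.exchange, Function.update_apply]
  have a4 : ∀ c (z : Fin n), s'.arr (σ + 4) c z = if s'.row n σ 0 z = c then 1 else 0 := by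
    intro c z
    have hxk : s.arr σ 0 x ≠ k := hlt.ne
    have hyk : s.arr σ 0 y = k := hfree
    have h1 : s'.arr (σ + 4) c z = if c = s.arr σ 0 x ∧ z = y then 1 else if c = k ∧ z = y then 0
        else if c = k ∧ z = x then 1 else if c = s.arr σ 0 x ∧ z = x then 0
        else s.arr (σ + 4) c z := by
      rw [← hs']
      simp [Store.setReg, Store.setArr, Expr.val, hx, hy, hk, Fin.val_inj]
    rw [h1, a0, h.table]
    by_cases h2 : z = y
    · subst h2
      rw [exchange_right]
      simp only [Store.row, and_true, hne.symm, and_false, if_false]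
      by_cases h3 : c = s.arr σ 0 x
      · simp [h3]
      · simp only [h3, if_false, Ne.symm h3]
        by_cases h4 : c = k
        · simp [h4]
        · simp [h4, hyk, Ne.symm h4]
    · by_cases h3 : z = x
      · subst h3
        rw [exchange_left hne]
        simp only [and_true, h2, and_false, if_false]
        by_cases h4 : c = k
        · simp [h4]
        · simp only [h4, if_false, Ne.symm h4]
          by_cases h5 : c = s.arr σ 0 z
          · simp [h5]
          · simp [h5, Ne.symm h5]
      · rw [exchange_of_ne h3 h2]
        simp only [h2, h3, and_false, if_false]
        rfl
  clear hs'
  refine (Runs.record r0 hN).imp fun t ht hP => ?_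
  have b0 : t.arr σ = s'.arr σ := ht.2 _ (by simp [Prog.record, Prog.for, Prog.arrs])
  have b4 : t.arr (σ + 4) = s'.arr (σ + 4) :=
    ht.2 _ (by simp [Prog.record, Prog.for, Prog.arrs])
  have b5 : t.reg (σ + 5) = s.reg (σ + 5) + 1 :=
    (ht.1 _ (by simp [Prog.record, Prog.for, Prog.regs])).trans r5
  have c0 : t.row n σ 0 = _root_.exchange k (s.row n σ 0) x y := (Store.row_congr b0 n 0).trans a0
  have cold : ∀ i ≤ s.reg (σ + 5), t.row n (σ + 2) i = s.row n (σ + 2) i := by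
    intro i hi
    funext z
    simp only [Store.row]
    rw [hP.2 i (by omega), a2]
  have cnew : t.row n (σ + 2) (s.reg (σ + 5) + 1) = _root_.exchange k (s.row n σ 0) x y := by
    rw [← r5, hP.1, a0]
  refine ⟨⟨?_, ?_, ?_, ?_, fun i hi => ?_⟩, c0, b5⟩
  · rw [c0]; exact h.valid.exchange hA hfree
  · intro c z
    rw [b4, a4, ← Store.row_congr b0 n 0]
    rfl
  · rw [cold 0 (by omega), h.first]
  · rw [b5, cnew, c0]
  · rw [b5] at hi
    rcases Nat.lt_succ_iff_lt_or_eq.1 hi with hi | rfl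
    · rw [cold i (by omega), cold (i + 1) (by omega)]
      exact h.steps i hi
    · rw [cold _ le_rfl, cnew, h.last]
      exact labelStep_exchange h.valid hA hfree

end Sides

/-! ### Searching for exchanges -/

section Searching

variable {n k : ℕ} {M : Fin k → Matroid (Fin n)} {f₀ : Fin n → ℕ} {σ τ : ℕ} {s : Store} {N : ℕ}
  {O : ℕ → Set ℕ → Prop}

theorem IsSide.setReg (h : IsSide M f₀ σ s) {r v : ℕ} (hr : r ≠ σ + 5) :
    IsSide M f₀ σ (s.setReg r v) :=
  h.congr rfl rfl rfl (by simp [Store.setReg, Function.update_of_ne hr.symm])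

/-- Find an element that has the label stored in register `10` on side `σ` but not on side `τ`, and
that can be exchanged on side `σ` for the element in register `8`. It is stored in register `9`. -/
def Prog.source (σ τ : ℕ) : Prog :=
  .for 2 0 <|
    .ite (.and (.eq (.cell σ (.reg 2)) (.reg 10)) (.not (.eq (.cell τ (.reg 2)) (.reg 10))))
      (.seq (.query σ 2 8) (.ite (.eq (.reg 4) (.lit 1)) (.set 9 (.reg 2)) .skip))
      .skip

theorem Runs.source {y : Fin n} {c : ℕ} (hσ : σ = 1 ∨ σ = 2) (h : IsSide M f₀ σ s)
    (hn : s.reg 0 = n) (hN : n < N) (hy : s.reg 8 = y) (hc : s.reg 10 = c)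
    (hyc : s.row n σ 0 y ≠ c)
    (hex : ∃ x, s.row n σ 0 x = c ∧ s.row n τ 0 x ≠ c ∧ Arc M (s.row n σ 0) x y) :
    Runs (basisOracle M) N (Prog.source σ τ) s fun t => t.arr = s.arr ∧
      ∃ x : Fin n, t.reg 9 = x ∧ s.row n σ 0 x = c ∧ s.row n τ 0 x ≠ c ∧
        Arc M (s.row n σ 0) x y := by
  refine Runs.for (m := n) (fun j t => t.arr = s.arr ∧ ∀ x : Fin n, (x : ℕ) < j →
      (s.row n σ 0 x = c ∧ s.row n τ 0 x ≠ c ∧ Arc M (s.row n σ 0) x y) →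
      ∃ z : Fin n, t.reg 9 = z ∧ s.row n σ 0 z = c ∧ s.row n τ 0 z ≠ c ∧
        Arc M (s.row n σ 0) z y) hn hN (by simp [Prog.regs, Prog.query])
    (by simp [Prog.for, Prog.regs, Prog.query]) ⟨rfl, by simp⟩ ?_ ?_
  · rintro j hj t ht hr ⟨h1, h2⟩
    have e8 : t.reg 8 = y := (ht.1 _ (by simp [Prog.for, Prog.regs, Prog.query])).trans hy
    have e10 : t.reg 10 = c := (ht.1 _ (by simp [Prog.for, Prog.regs, Prog.query])).trans hc
    have e5 : t.reg (σ + 5) = s.reg (σ + 5) :=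
      ht.1 _ (by rcases hσ with rfl | rfl <;> simp [Prog.for, Prog.regs, Prog.query])
    have hs : IsSide M f₀ σ t := h.congr (by rw [h1]) (by rw [h1]) (by rw [h1]) e5
    have hrow : ∀ a, t.row n a 0 = s.row n a 0 := fun a => Store.row_congr (by rw [h1]) n 0
    -- the element `j` is passed over if it is not of the required kind
    have hskip : ∀ t' : Store, t'.arr = s.arr → t'.reg 9 = t.reg 9 →
        ¬ (s.row n σ 0 ⟨j, hj⟩ = c ∧ s.row n τ 0 ⟨j, hj⟩ ≠ c ∧ Arc M (s.row n σ 0) ⟨j, hj⟩ y) →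
        (t'.setReg 2 (j + 1)).arr = s.arr ∧ ∀ x : Fin n, (x : ℕ) < j + 1 →
        (s.row n σ 0 x = c ∧ s.row n τ 0 x ≠ c ∧ Arc M (s.row n σ 0) x y) →
        ∃ z : Fin n, (t'.setReg 2 (j + 1)).reg 9 = z ∧ s.row n σ 0 z = c ∧ s.row n τ 0 z ≠ c ∧
          Arc M (s.row n σ 0) z y := by
      intro t' e1 e2 hno
      refine ⟨e1, fun x hx hgood => ?_⟩
      have hx' : (x : ℕ) < j := by
        refine lt_of_le_of_ne (by omega) fun e => hno ?_
        have : x = ⟨j, hj⟩ := Fin.ext e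
        rwa [← this]
      obtain ⟨z, hz⟩ := h2 x hx' hgood
      exact ⟨z, by simpa [Store.setReg, e2] using hz⟩
    refine .ite (fun hb => ?_) (fun hb => ?_)
    · simp only [Test.holds, Expr.val, hr, e10, h1] at hb
      refine .seq (Runs.query (x := ⟨j, hj⟩) hs hr e8 ?_ (by decide) (by decide) fun v hv => ?_)
      · rw [hrow]; exact fun e => hyc (e.trans hb.1)
      rw [hrow] at hv
      refine .ite (fun hv' => .set ⟨h1, fun _ _ _ => ⟨⟨j, hj⟩, ?_⟩⟩) (fun hv' => .skip ?_)
      · refine ⟨by simp [Store.setReg, Expr.val, hr], hb.1, hb.2, hv.1 ?_⟩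
        simpa [Test.holds, Expr.val, Store.setReg] using hv'
      · refine hskip _ h1 (by simp [Store.setReg]) fun hgood => hv' ?_
        simpa [Test.holds, Expr.val, Store.setReg] using hv.2 hgood.2.2
    · refine .skip (hskip _ h1 rfl fun hgood => hb ?_)
      simp only [Test.holds, Expr.val, hr, e10, h1]
      exact ⟨hgood.1, hgood.2.1⟩
  · rintro t - ⟨h1, h2⟩
    obtain ⟨x, hx⟩ := hex
    exact ⟨h1, h2 x x.2 hx⟩

/-- Find an element that is free on side `1` but not on side `2`. It is stored in register `8`; if
there is none, this register is set to `n`. -/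
def Prog.target : Prog :=
  .seq (.set 8 (.reg 0)) <|
  .for 2 0 <|
    .ite (.and (.eq (.cell 1 (.reg 2)) (.reg 1)) (.not (.eq (.cell 2 (.reg 2)) (.reg 1))))
      (.set 8 (.reg 2)) .skip

theorem Runs.target (hn : s.reg 0 = n) (hk : s.reg 1 = k) (hN : n < N) :
    Runs O N Prog.target s fun t =>
      (t.reg 8 = n ∧ ∀ y, s.row n 1 0 y = k → s.row n 2 0 y = k) ∨
      ∃ y : Fin n, t.reg 8 = y ∧ s.row n 1 0 y = k ∧ s.row n 2 0 y ≠ k := by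
  refine .seq (.set (Runs.for (m := n) (fun j t =>
      (t.reg 8 = n ∧ ∀ y : Fin n, (y : ℕ) < j → s.row n 1 0 y = k → s.row n 2 0 y = k) ∨
      ∃ y : Fin n, t.reg 8 = y ∧ s.row n 1 0 y = k ∧ s.row n 2 0 y ≠ k)
      (by simpa [Store.setReg] using hn) hN (by decide) (by decide)
      (Or.inl ⟨by simp [Store.setReg, Expr.val, hn], by simp⟩) ?_ ?_))
  · rintro j hj t ht hr h1
    have e1 : t.reg 1 = k := (ht.1 1 (by decide)).trans (by simp [Store.setReg, hk])
    have a1 : t.arr 1 = s.arr 1 := ht.2 1 (by decide)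
    have a2 : t.arr 2 = s.arr 2 := ht.2 2 (by decide)
    refine .ite (fun hb => .set (Or.inr ⟨⟨j, hj⟩, ?_⟩)) (fun hb => .skip ?_) <;>
      simp only [Test.holds, Expr.val, hr, e1, a1, a2] at hb
    · exact ⟨by simp [Store.setReg, Expr.val, hr], hb⟩
    · rcases h1 with ⟨h1, h2⟩ | h1
      · refine Or.inl ⟨by simpa [Store.setReg] using h1, fun y hy hfy => ?_⟩
        rcases Nat.lt_succ_iff_lt_or_eq.1 hy with hy | rfl
        · exact h2 y hy hfy
        · by_contra hc
          exact hb ⟨hfy, hc⟩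
      · exact Or.inr (by simpa [Store.setReg] using h1)
  · rintro t - (⟨h1, h2⟩ | h1)
    · exact Or.inl ⟨h1, fun y => h2 y y.2⟩
    · exact Or.inr h1

/-! ### Breadth-first search on the machine -/

/-- Array `7` contains the queue `q`, whose length is in register `11`, and array `9` tells which
elements belong to it. -/
structure IsQueue (q : ℕ → Fin n) (s : Store) : Prop where
  entry : ∀ i < s.reg 11, s.arr 7 0 i = q i
  mem : ∀ x : Fin n, s.arr 9 0 x ≠ 0 ↔ ∃ i < s.reg 11, q i = x

/-- Initialize the queue with the elements on which the two sides differ. -/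
def Prog.seed : Prog :=
  .seq (.set 11 (.lit 0)) <|
  .for 2 0 <|
    .ite (.eq (.cell 1 (.reg 2)) (.cell 2 (.reg 2)))
      (.put 9 (.lit 0) (.reg 2) (.lit 0)) <|
      .seq (.put 9 (.lit 0) (.reg 2) (.lit 1)) <|
      .seq (.put 7 (.lit 0) (.reg 11) (.reg 2)) <|
      .set 11 (.succ (.reg 11))

theorem Runs.seed (hn : s.reg 0 = n) (h0 : 0 < n) (hN : n < N) :
    Runs O N Prog.seed s fun t => ∃ q, IsQueue q t ∧
      IsSearch M (s.row n 1 0) (s.row n 2 0) q (t.arr 8 0) (t.reg 11) (t.reg 11) 0 0 := by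
  refine .seq (.set (Runs.for (m := n) (fun j t => ∃ q : ℕ → Fin n,
      (∀ i < t.reg 11, t.arr 7 0 i = q i) ∧
      (∀ i < t.reg 11, ∀ i' < t.reg 11, q i = q i' → i = i') ∧
      (∀ i < t.reg 11, s.row n 1 0 (q i) ≠ s.row n 2 0 (q i) ∧ (q i : ℕ) < j) ∧
      (∀ x : Fin n, (x : ℕ) < j → s.row n 1 0 x ≠ s.row n 2 0 x → ∃ i < t.reg 11, q i = x) ∧
      (∀ x : Fin n, (x : ℕ) < j → (t.arr 9 0 x ≠ 0 ↔ s.row n 1 0 x ≠ s.row n 2 0 x)))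
      (by simpa [Store.setReg] using hn) hN (by decide) (by decide)
      ⟨fun _ => ⟨0, h0⟩, by simp [Store.setReg, Expr.val]⟩ ?_ ?_))
  · rintro j hj t ht hr ⟨q, h1, h2, h3, h4, h5⟩
    have a1 : t.arr 1 = s.arr 1 := ht.2 1 (by decide)
    have a2 : t.arr 2 = s.arr 2 := ht.2 2 (by decide)
    refine .ite (fun hb => .put ⟨q, ?_⟩) (fun hb => .seq (.put (.seq (.put (.set ?_))))) <;>
      simp only [Test.holds, Expr.val, hr, a1, a2] at hb
    · refine ⟨by simpa [Store.setReg, Store.setArr] using h1,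
        by simpa [Store.setReg, Store.setArr] using h2,
        fun i hi => ?_, fun x hx hD => ?_, fun x hx => ?_⟩
      · have := h3 i (by simpa [Store.setReg, Store.setArr] using hi)
        exact ⟨this.1, by omega⟩
      · have hx' : (x : ℕ) ≠ j := by
          rintro rfl
          exact hD hb
        obtain ⟨i, hi⟩ := h4 x (by omega) hD
        exact ⟨i, by simpa [Store.setReg, Store.setArr] using hi⟩
      · simp only [Store.setReg, Store.setArr, Expr.val, hr, true_and]
        rcases Nat.lt_succ_iff_lt_or_eq.1 hx with hx | rfl
        · rw [if_neg hx.ne]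
          exact h5 x hx
        · simp only [if_true, ne_eq, not_true_eq_false, false_iff, not_not]
          exact hb
    · generalize ht' : Store.setReg _ 2 (j + 1) = t'
      have r11 : t'.reg 11 = t.reg 11 + 1 := by
        rw [← ht']; simp [Store.setReg, Store.setArr, Expr.val]
      have c7 : ∀ i, t'.arr 7 0 i = if i = t.reg 11 then j else t.arr 7 0 i := by
        intro i
        rw [← ht']; simp [Store.setReg, Store.setArr, Expr.val, hr]
      have c9 : ∀ i, t'.arr 9 0 i = if i = j then 1 else t.arr 9 0 i := by
        intro i
        rw [← ht']; simp [Store.setReg, Store.setArr, Expr.val, hr]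
      have hold : ∀ i < t.reg 11, Function.update q (t.reg 11) ⟨j, hj⟩ i = q i :=
        fun i hi => Function.update_of_ne hi.ne _ _
      clear ht'
      refine ⟨Function.update q (t.reg 11) ⟨j, hj⟩, ?_⟩
      rw [r11]
      refine ⟨fun i hi => ?_, fun i hi i' hi' e => ?_, fun i hi => ?_, fun x hx hD => ?_,
        fun x hx => ?_⟩
      · rw [c7]
        rcases Nat.lt_succ_iff_lt_or_eq.1 hi with hi | rfl
        · rw [if_neg hi.ne, hold i hi]; exact h1 i hi
        · simp
      · rcases Nat.lt_succ_iff_lt_or_eq.1 hi with hi | rfl <;>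
          rcases Nat.lt_succ_iff_lt_or_eq.1 hi' with hi' | rfl
        · rw [hold i hi, hold i' hi'] at e
          exact h2 i hi i' hi' e
        · rw [hold i hi, Function.update_self] at e
          have := (h3 i hi).2
          rw [e] at this
          exact (lt_irrefl _ this).elim
        · rw [hold i' hi', Function.update_self] at e
          have := (h3 i' hi').2
          rw [← e] at this
          exact (lt_irrefl _ this).elim
        · rfl
      · rcases Nat.lt_succ_iff_lt_or_eq.1 hi with hi | rfl
        · rw [hold i hi]
          exact ⟨(h3 i hi).1, (h3 i hi).2.trans (by omega)⟩
        · rw [Function.update_self]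
          exact ⟨hb, by simp⟩
      · rcases Nat.lt_succ_iff_lt_or_eq.1 hx with hx | hx
        · obtain ⟨i, hi, e⟩ := h4 x hx hD
          exact ⟨i, by omega, by rw [hold i hi, e]⟩
        · exact ⟨t.reg 11, by omega, by rw [Function.update_self]; exact Fin.ext hx.symm⟩
      · rw [c9]
        rcases Nat.lt_succ_iff_lt_or_eq.1 hx with hx | rfl
        · rw [if_neg hx.ne]; exact h5 x hx
        · simpa [Store.row] using hb
  · rintro t - ⟨q, h1, h2, h3, h4, h5⟩
    refine ⟨q, ⟨h1, fun x => ?_⟩, .start h2 (fun i hi => (h3 i hi).1) fun x => h4 x x.2⟩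
    rw [h5 x x.2]
    refine ⟨h4 x x.2, ?_⟩
    rintro ⟨i, hi, rfl⟩
    exact (h3 i hi).1

/-- Append all unvisited elements to the queue for which the element in register `9` can be
exchanged. -/
def Prog.scan : Prog :=
  .for 2 0 <|
    .ite (.and (.eq (.cell 9 (.reg 2)) (.lit 0))
        (.not (.eq (.cell 1 (.reg 2)) (.cell 1 (.reg 9)))))
      (.seq (.query 1 9 2) <|
        .ite (.eq (.reg 4) (.lit 1))
          (.seq (.put 9 (.lit 0) (.reg 2) (.lit 1)) <|
            .seq (.put 7 (.lit 0) (.reg 11) (.reg 2)) <|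
            .seq (.put 8 (.lit 0) (.reg 11) (.reg 12)) <|
            .set 11 (.succ (.reg 11)))
          .skip)
      .skip

theorem IsQueue.congr {q : ℕ → Fin n} {t : Store} (h : IsQueue q s) (h7 : t.arr 7 = s.arr 7)
    (h9 : t.arr 9 = s.arr 9) (h11 : t.reg 11 = s.reg 11) : IsQueue q t := by
  refine ⟨?_, ?_⟩
  · rw [h7, h11]; exact h.entry
  · rw [h9, h11]; exact h.mem

theorem Runs.scan {f g : Fin n → ℕ} {q : ℕ → Fin n} {d head : ℕ} (h : IsSide M f₀ 1 s)
    (hf : s.row n 1 0 = f) (hn : s.reg 0 = n) (hN : n < N) (hq : IsQueue q s)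
    (hS : IsSearch M f g q (s.arr 8 0) d (s.reg 11) head 0) (hhead : s.reg 12 = head)
    (hlt : head < s.reg 11) (h9 : s.reg 9 = q head) :
    Runs (basisOracle M) N Prog.scan s fun t => ∃ q, IsQueue q t ∧
      IsSearch M f g q (t.arr 8 0) d (t.reg 11) head n ∧ t.arr 5 = s.arr 5 ∧ head < t.reg 11 := by
  refine Runs.for (m := n) (fun j t => ∃ q, IsQueue q t ∧ t.reg 9 = q head ∧ head < t.reg 11 ∧
      IsSearch M f g q (t.arr 8 0) d (t.reg 11) head j ∧ t.arr 5 = s.arr 5)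
    hn hN (by decide) (by decide) ⟨q, hq.congr rfl rfl (by simp [Store.setReg]),
      by simpa [Store.setReg] using ⟨h9, hlt, hS⟩⟩ ?_ ?_
  · rintro j hj t ht hr ⟨q, h1, h2, h3, h4, h5⟩
    have a1 : t.arr 1 = s.arr 1 := ht.2 1 (by decide)
    have a3 : t.arr 3 = s.arr 3 := ht.2 3 (by decide)
    have e12 : t.reg 12 = head := (ht.1 12 (by decide)).trans hhead
    have hs : IsSide M f₀ 1 t := h.congr a1 a3 h5 (ht.1 6 (by decide))
    have hrow : t.row n 1 0 = f := (Store.row_congr a1 n 0).trans hf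
    have hval : ∀ x : Fin n, t.arr 1 0 x = f x := fun x => congrFun hrow x
    refine .ite (fun hb => ?_) (fun hb => .skip ?_)
    · simp only [Test.holds, Expr.val, hr, h2] at hb
      obtain ⟨hb1, hb2⟩ := hb
      have hnot : ∀ i < t.reg 11, q i ≠ ⟨j, hj⟩ := by
        intro i hi e
        exact (h1.mem ⟨j, hj⟩).2 ⟨i, hi, e⟩ hb1
      refine .seq (Runs.query (x := q head) (y := ⟨j, hj⟩) hs h2 hr hb2 (by decide) (by decide)
        fun v hv => .ite (fun hb => .seq (.put (.seq (.put (.seq (.put (.set ?_))))))) fun hb =>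
          .skip ?_)
      · simp only [Test.holds, Expr.val, Store.setReg, Function.update_self] at hb
        rw [hrow] at hv
        generalize ht' : Store.setReg _ 2 (j + 1) = t'
        have r11 : t'.reg 11 = t.reg 11 + 1 := by
          rw [← ht']; simp [Store.setReg, Store.setArr, Expr.val]
        have r9 : t'.reg 9 = t.reg 9 := by
          rw [← ht']; simp [Store.setReg, Store.setArr]
        have c5 : t'.arr 5 = t.arr 5 := by
          rw [← ht']; simp [Store.setReg, Store.setArr]
        have c7 : ∀ i, t'.arr 7 0 i = if i = t.reg 11 then j else t.arr 7 0 i := by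
          intro i
          rw [← ht']; simp [Store.setReg, Store.setArr, Expr.val, hr]
        have c8 : ∀ i, t'.arr 8 0 i = if i = t.reg 11 then head else t.arr 8 0 i := by
          intro i
          rw [← ht']; simp [Store.setReg, Store.setArr, Expr.val, e12]
        have c9 : ∀ i, t'.arr 9 0 i = if i = j then 1 else t.arr 9 0 i := by
          intro i
          rw [← ht']; simp [Store.setReg, Store.setArr, Expr.val, hr]
        clear ht'
        have hold : ∀ i < t.reg 11, Function.update q (t.reg 11) ⟨j, hj⟩ i = q i :=
          fun i hi => Function.update_of_ne hi.ne _ _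
        refine ⟨Function.update q (t.reg 11) ⟨j, hj⟩, ⟨?_, fun x => ?_⟩, ?_, by omega, ?_,
          c5.trans h5⟩
        · intro i hi
          rw [r11] at hi
          rw [c7]
          rcases Nat.lt_succ_iff_lt_or_eq.1 hi with hi | rfl
          · rw [if_neg hi.ne, hold i hi]; exact h1.entry i hi
          · simp
        · rw [c9, r11]
          split
          · rename_i hx
            simp only [ne_eq, one_ne_zero, not_false_iff, true_iff]
            exact ⟨t.reg 11, by omega, by rw [Function.update_self]; exact Fin.ext hx.symm⟩
          · rename_i hx
            rw [h1.mem]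
            constructor
            · rintro ⟨i, hi, e⟩
              exact ⟨i, by omega, by rw [hold i hi, e]⟩
            · rintro ⟨i, hi, e⟩
              rcases Nat.lt_succ_iff_lt_or_eq.1 hi with hi | rfl
              · exact ⟨i, hi, by rwa [hold i hi] at e⟩
              · rw [Function.update_self] at e
                exact (hx (by rw [← e])).elim
        · rw [r9, h2, hold _ h3]
        · rw [r11]
          refine h4.push (y := ⟨j, hj⟩) rfl hnot (hv.1 hb) h3 hold (Function.update_self ..)
            (fun i hi => ?_) ?_
          · rw [c8, if_neg hi.ne]
          · rw [c8, if_pos rfl]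
      · simp only [Test.holds, Expr.val, Store.setReg, Function.update_self] at hb
        rw [hrow] at hv
        refine ⟨q, h1.congr rfl rfl (by simp [Store.setReg]), by simpa [Store.setReg] using h2,
          by simpa [Store.setReg] using h3, ?_, h5⟩
        have := h4.skip (y := ⟨j, hj⟩) rfl (Or.inr fun hA => hb (hv.2 hA))
        simpa [Store.setReg] using this
    · refine ⟨q, h1.congr rfl rfl (by simp [Store.setReg]), by simpa [Store.setReg] using h2,
        by simpa [Store.setReg] using h3, ?_, h5⟩
      have : IsSearch M f g q (t.arr 8 0) d (t.reg 11) head (j + 1) := by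
        refine h4.skip (y := ⟨j, hj⟩) rfl ?_
        rw [← h1.mem]
        by_contra! hc
        refine hb ?_
        simp only [Test.holds, Expr.val, hr, h2]
        refine ⟨hc.1, ?_⟩
        have := hc.2.1
        rwa [← hval, ← hval] at this
      simpa [Store.setReg] using this
  · rintro t - ⟨q, h1, h2, h3, h4, h5⟩
    exact ⟨q, h1, h4, h5, h3⟩

/-- Process the queue until it is exhausted. -/
def Prog.explore : Prog :=
  .seq (.set 12 (.lit 0)) <|
  .loop (.lt (.reg 12) (.reg 11)) <|
    .seq (.set 9 (.cell 7 (.reg 12))) <|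
    .seq .scan <|
    .set 12 (.succ (.reg 12))

theorem Runs.explore {f g : Fin n → ℕ} {q : ℕ → Fin n} {d : ℕ} (h : IsSide M f₀ 1 s)
    (hf : s.row n 1 0 = f) (hn : s.reg 0 = n) (hN : n < N) (hq : IsQueue q s)
    (hS : IsSearch M f g q (s.arr 8 0) d (s.reg 11) 0 0) :
    Runs (basisOracle M) N Prog.explore s fun t => ∃ q, IsQueue q t ∧
      IsSearch M f g q (t.arr 8 0) d (t.reg 11) (t.reg 11) 0 ∧ t.arr 5 = s.arr 5 := by
  refine .seq (.set (.loop (fun t => ∃ q, IsQueue q t ∧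
    IsSearch M f g q (t.arr 8 0) d (t.reg 11) (t.reg 12) 0 ∧ t.arr 5 = s.arr 5 ∧
      t.reg 12 ≤ t.reg 11) (fun t => n - t.reg 12) ?_ (by omega) ?_ ?_))
  · refine ⟨q, hq.congr rfl rfl (by simp [Store.setReg]), ?_⟩
    simpa [Store.setReg, Expr.val] using hS
  · rintro t ht ⟨q, h1, h2, h3, h4⟩ hb
    simp only [Test.holds, Expr.val] at hb
    have a1 : t.arr 1 = s.arr 1 := ht.2 1 (by decide)
    have hs : IsSide M f₀ 1 t := h.congr a1 (ht.2 3 (by decide)) h3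
      ((ht.1 6 (by decide)).trans (by simp [Store.setReg]))
    have hle := h2.tail_le
    refine .seq (.set (.seq ((Runs.scan (hs.setReg (by decide)) ((Store.row_congr a1 n 0).trans hf)
      ?_ hN (h1.congr rfl rfl (by simp [Store.setReg])) (head := t.reg 12)
      (by simpa [Store.setReg] using h2) (by simp [Store.setReg]) (by simpa [Store.setReg] using hb)
      ?_).imp ?_)))
    · simp only [Store.setReg]
      exact (ht.1 0 (by decide)).trans (by simp [Store.setReg, hn])
    · simp only [Store.setReg, Function.update_self, Expr.val]
      exact h1.entry _ hb
    · rintro t' ht' ⟨q', h5, h6, h7, h8⟩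
      have e12 : t'.reg 12 = t.reg 12 := (ht'.1 12 (by decide)).trans (by simp [Store.setReg])
      refine .set ⟨⟨q', h5.congr rfl rfl (by simp [Store.setReg]), ?_, h7.trans h3, ?_⟩, ?_⟩
      · simpa [Store.setReg, Expr.val, e12] using h6.next
      · simpa [Store.setReg, Expr.val, e12] using h8
      · simp [Store.setReg, Expr.val, e12]
        omega
  · rintro t ht ⟨q, h1, h2, h3, h4⟩ hb
    simp only [Test.holds, Expr.val, not_lt] at hb
    rw [le_antisymm h4 hb] at h2
    exact ⟨q, h1, h2, h3⟩

/-- Find an entry of the queue that is free on side `1`; its index is stored in register `14`. If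
there is none, this register is set to the length of the queue. -/
def Prog.findFree : Prog :=
  .seq (.set 14 (.reg 11)) <|
  .for 2 11 <|
    .ite (.eq (.cell 1 (.cell 7 (.reg 2))) (.reg 1)) (.set 14 (.reg 2)) .skip

theorem Runs.findFree {f : Fin n → ℕ} {q : ℕ → Fin n} (hf : s.row n 1 0 = f) (hk : s.reg 1 = k)
    (hq : IsQueue q s) (hN : s.reg 11 < N) :
    Runs O N Prog.findFree s fun t => (t.reg 14 = s.reg 11 ∧ ∀ i < s.reg 11, f (q i) ≠ k) ∨
      (t.reg 14 < s.reg 11 ∧ f (q (t.reg 14)) = k) := by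
  refine .seq (.set (Runs.for (m := s.reg 11) (fun j t =>
    (t.reg 14 = s.reg 11 ∧ ∀ i < j, f (q i) ≠ k) ∨ (t.reg 14 < s.reg 11 ∧ f (q (t.reg 14)) = k))
    (by simp [Store.setReg]) hN (by decide) (by decide)
    (Or.inl ⟨by simp [Store.setReg, Expr.val], by simp⟩) ?_ (fun t _ h => h)))
  rintro j hj t ht hr h1
  have e1 : t.reg 1 = k := (ht.1 1 (by decide)).trans (by simp [Store.setReg, hk])
  have a1 : t.arr 1 = s.arr 1 := ht.2 1 (by decide)
  have a7 : t.arr 7 = s.arr 7 := ht.2 7 (by decide)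
  have hval : ∀ x : Fin n, s.arr 1 0 x = f x := fun x => congrFun hf x
  refine .ite (fun hb => .set ?_) (fun hb => .skip ?_) <;>
    simp only [Test.holds, Expr.val, hr, e1, a1, a7, hq.entry j hj, hval] at hb
  · exact Or.inr (by simpa [Store.setReg, Expr.val, hr] using ⟨hj, hb⟩)
  · rcases h1 with ⟨h1, h2⟩ | h1
    · refine Or.inl ⟨by simpa [Store.setReg] using h1, fun i hi => ?_⟩
      rcases Nat.lt_succ_iff_lt_or_eq.1 hi with hi | rfl
      · exact h2 i hi
      · exact hb
    · exact Or.inr (by simpa [Store.setReg] using h1)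

/-! ### Augmentation on the machine -/

/-- Follow the search tree from the entry in register `14` of the queue to one of its first entries,
whose number is in register `13`. The path is stored in array `10`, its length in register `15`, and
the last vertex but one in register `8`. -/
def Prog.extract : Prog :=
  .seq (.set 15 (.lit 0)) <|
  .seq (.put 10 (.lit 0) (.lit 0) (.cell 7 (.reg 14))) <|
  .loop (.not (.lt (.reg 14) (.reg 13))) <|
    .seq (.set 8 (.cell 10 (.reg 15))) <|
    .seq (.set 14 (.cell 8 (.reg 14))) <|
    .seq (.set 15 (.succ (.reg 15))) <|
    .put 10 (.lit 0) (.reg 15) (.cell 7 (.reg 14))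

theorem Runs.extract {f g : Fin n → ℕ} {q : ℕ → Fin n} {ch : ℕ → ℕ} {d head i t₀ : ℕ}
    (hN : n < N) (hq : IsQueue q s) (hch : s.arr 8 0 = ch)
    (hS : IsSearch M f g q ch d (s.reg 11) head i) (hd : s.reg 13 = d) (ht₀ : s.reg 14 = t₀)
    (hlt : t₀ < s.reg 11) (hle : d ≤ t₀) :
    Runs O N Prog.extract s fun t => ∃ L, t.reg 15 = L + 1 ∧ t.reg 8 = q (ch^[L] t₀) ∧
      (∀ a ≤ L, d ≤ ch^[a] t₀) ∧ ch^[L + 1] t₀ < d ∧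
      ∀ a ≤ L + 1, t.arr 10 0 a = q (ch^[a] t₀) := by
  have hs : ∀ a, ch^[a + 1] t₀ = ch (ch^[a] t₀) := fun a => Function.iterate_succ_apply' ch a t₀
  have htail := hS.tail_le
  refine .seq (.set (.seq (.put (.loop (fun t => t.reg 14 = ch^[t.reg 15] t₀ ∧
    t.reg 14 < s.reg 11 ∧ (∀ a < t.reg 15, d ≤ ch^[a] t₀) ∧
    (∀ a ≤ t.reg 15, t.arr 10 0 a = q (ch^[a] t₀)) ∧
    ∀ L, t.reg 15 = L + 1 → t.reg 8 = q (ch^[L] t₀)) (fun t => t.reg 14) ?_ ?_ ?_ ?_))))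
  · simp only [Store.setReg, Store.setArr, Expr.val]
    refine ⟨by simp [ht₀], by simp [ht₀, hlt], by simp, ?_, by simp⟩
    simp [ht₀, hq.entry _ hlt]
  · simp only [Store.setReg, Store.setArr]
    simp [ht₀]
    omega
  · rintro t ht ⟨h1, h2, h3, h4, h5⟩ hb
    have e13 : t.reg 13 = d := (ht.1 13 (by decide)).trans (by simp [Store.setReg, Store.setArr, hd])
    have a7 : t.arr 7 = s.arr 7 := (ht.2 7 (by decide)).trans (by simp [Store.setReg, Store.setArr])
    have a8 : t.arr 8 0 = ch := by
      rw [ht.2 8 (by decide), ← hch]; simp [Store.setReg, Store.setArr]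
    simp only [Test.holds, Expr.val, e13, not_lt] at hb
    have hch' : ch (t.reg 14) < t.reg 14 := hS.lt _ hb h2
    refine .seq (.set (.seq (.set (.seq (.set (.put ?_))))))
    generalize ht' : Store.setArr _ 10 _ _ _ = t'
    have r14 : t'.reg 14 = ch (t.reg 14) := by
      rw [← ht']; simp [Store.setReg, Store.setArr, Expr.val, a8]
    have r15 : t'.reg 15 = t.reg 15 + 1 := by
      rw [← ht']; simp [Store.setReg, Store.setArr, Expr.val]
    have r8 : t'.reg 8 = t.arr 10 0 (t.reg 15) := by
      rw [← ht']; simp [Store.setReg, Store.setArr, Expr.val]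
    have c10 : ∀ a, t'.arr 10 0 a = if a = t.reg 15 + 1 then t.arr 7 0 (ch (t.reg 14))
        else t.arr 10 0 a := by
      intro a
      rw [← ht']; simp [Store.setReg, Store.setArr, Expr.val, a8]
    clear ht'
    refine ⟨⟨?_, by omega, fun a ha => ?_, fun a ha => ?_, fun L hL => ?_⟩, by omega⟩
    · rw [r14, r15, hs, h1]
    · rw [r15] at ha
      rcases Nat.lt_succ_iff_lt_or_eq.1 ha with ha | rfl
      · exact h3 a ha
      · rwa [← h1]
    · rw [r15] at ha
      rw [c10]
      split
      · rename_i e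
        rw [a7, hq.entry _ (by omega), e, hs, h1]
      · exact h4 a (by omega)
    · obtain rfl : t.reg 15 = L := by omega
      rw [r8, h4 _ le_rfl]
  · rintro t ht ⟨h1, h2, h3, h4, h5⟩ hb
    have e13 : t.reg 13 = d := (ht.1 13 (by decide)).trans (by simp [Store.setReg, Store.setArr, hd])
    simp only [Test.holds, Expr.val, e13, not_not] at hb
    rcases hL : t.reg 15 with _ | L
    · rw [hL] at h1
      simp only [Function.iterate_zero, id_eq] at h1
      omega
    · rw [hL] at h1 h3 h4
      exact ⟨L, rfl, h5 L hL, fun a ha => h3 a (by omega), h1 ▸ hb, h4⟩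

/-- Shift side `σ` along the path in array `10`, whose length is in register `15`. -/
def Prog.walk (σ : ℕ) : Prog :=
  .for 3 15 <|
    .seq (.set 9 (.cell 10 (.succ (.reg 3)))) <|
    .seq (.set 8 (.cell 10 (.reg 3))) <|
    .exchange σ

theorem Runs.walk {p : ℕ → Fin n} {L : ℕ} (hσ : σ = 1 ∨ σ = 2) (h : IsSide M f₀ σ s)
    (hn : s.reg 0 = n) (hk : s.reg 1 = k) (hN : n < N) (hL : s.reg 15 = L)
    (hp : ∀ a ≤ L, s.arr 10 0 a = p a) (hpath : IsShiftPath M (s.row n σ 0) p 0 L)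
    (hinj : ∀ a ≤ L, ∀ b ≤ L, p a = p b → a = b) :
    Runs O N (Prog.walk σ) s fun t => IsSide M f₀ σ t ∧
      IsShifted k (s.row n σ 0) p L (t.row n σ 0) ∧ t.reg (σ + 5) = s.reg (σ + 5) + L := by
  have hLn : L + 1 ≤ n := le_of_injOn (q := p) fun a ha b hb => hinj a (by omega) b (by omega)
  refine Runs.for (m := L) (fun j t => IsSide M f₀ σ t ∧ IsShiftPath M (t.row n σ 0) p j L ∧
    IsShifted k (s.row n σ 0) p j (t.row n σ 0) ∧ t.reg (σ + 5) = s.reg (σ + 5) + j) hL (by omega)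
    ?_ ?_ ⟨h.setReg (by omega), hpath, ⟨by simp, hpath.free, fun _ _ => rfl⟩, ?_⟩ ?_ ?_
  · rcases hσ with rfl | rfl <;> decide
  · rcases hσ with rfl | rfl <;> decide
  · simp [Store.setReg]
  · rintro j hj t ht hr ⟨h1, h2, h3, h4⟩
    have e0 : t.reg 0 = n := (ht.1 0 (by rcases hσ with rfl | rfl <;> decide)).trans hn
    have e1 : t.reg 1 = k := (ht.1 1 (by rcases hσ with rfl | rfl <;> decide)).trans hk
    have a10 : t.arr 10 = s.arr 10 := ht.2 10 (by rcases hσ with rfl | rfl <;> decide)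
    refine .seq (.set (.seq (.set ((Runs.exchange (x := p (j + 1)) (y := p j) hσ
      ((h1.setReg (by omega)).setReg (by omega)) ?_ hN ?_ ?_ ?_ (h2.arc j le_rfl hj)
      h2.free).imp ?_))))
    · simpa [Store.setReg] using e0
    · simpa [Store.setReg] using e1
    · simp [Store.setReg, Expr.val, hr, a10, hp (j + 1) hj]
    · simp [Store.setReg, Expr.val, hr, a10, hp j hj.le]
    · rintro t' - ⟨h5, h6, h7⟩
      have h6' : t'.row n σ 0 = _root_.exchange k (t.row n σ 0) (p (j + 1)) (p j) := h6
      have hr' : (t'.setReg 3 (j + 1)).row n σ 0 = t'.row n σ 0 := rfl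
      refine ⟨h5.setReg (by omega), ?_, ?_, ?_⟩
      · rw [hr', h6']
        exact h2.exchange h1.valid hinj hj
      · rw [hr', h6']
        exact h3.exchange hinj hj
      · have e3 : σ + 5 ≠ 3 := by omega
        have e8 : σ + 5 ≠ 8 := by omega
        have e9 : σ + 5 ≠ 9 := by omega
        simp only [Store.setReg, Function.update_of_ne e3]
        rw [h7]
        simp only [Store.setReg, Function.update_of_ne e8, Function.update_of_ne e9]
        omega
  · rintro t - ⟨h1, h2, h3, h4⟩
    exact ⟨h1, h3, h4⟩

end Searching

/-! ### One iteration -/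

section Iteration

variable {n k : ℕ} {M : Fin k → Matroid (Fin n)} {f₀ g₀ : Fin n → ℕ} {s : Store} {N : ℕ}

/-- Shift both sides along the path that ends in the free entry of the queue in register `14`; on
side `2`, the first vertex of the path is replaced by an element that has the same label there. -/
def Prog.augment : Prog :=
  .seq .extract <|
  .seq (.set 10 (.cell 1 (.cell 10 (.reg 15)))) <|
  .seq (.source 2 1) <|
  .seq (.set 16 (.reg 9)) <|
  .seq (.walk 1) <|
  .seq (.put 10 (.lit 0) (.reg 15) (.reg 16)) <|
  .walk 2

theorem Runs.augment {q : ℕ → Fin n} {d head i t₀ : ℕ} (h1 : IsSide M f₀ 1 s)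
    (h2 : IsSide M g₀ 2 s) (hn : s.reg 0 = n) (hk : s.reg 1 = k) (hN : n < N)
    (hfree : ∀ y, s.row n 1 0 y = k → s.row n 2 0 y = k) (hq : IsQueue q s)
    (hS : IsSearch M (s.row n 1 0) (s.row n 2 0) q (s.arr 8 0) d (s.reg 11) head i)
    (hd : s.reg 13 = d) (ht₀ : s.reg 14 = t₀) (hlt : t₀ < s.reg 11)
    (hft₀ : s.row n 1 0 (q t₀) = k) :
    Runs (basisOracle M) N Prog.augment s fun t => IsSide M f₀ 1 t ∧ IsSide M g₀ 2 t ∧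
      discrepancy k (t.row n 1 0) (t.row n 2 0) < discrepancy k (s.row n 1 0) (s.row n 2 0) ∧
      t.reg 6 ≤ s.reg 6 + n ∧ t.reg 7 ≤ s.reg 7 + n := by
  have hle : d ≤ t₀ := by
    by_contra hc
    exact hS.seed t₀ (by omega) (hft₀.trans (hfree _ hft₀).symm)
  refine .seq ((Runs.extract hN hq rfl hS hd ht₀ hlt hle).imp ?_)
  rintro t ht ⟨L, r15, r8, hL, hL', hpath⟩
  set f := s.row n 1 0 with hf
  set g := s.row n 2 0 with hg
  have arrs : ∀ a, a ≠ 10 → t.arr a = s.arr a := fun a ha =>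
    ht.2 a (by simpa [Prog.extract, Prog.arrs] using ha)
  obtain ⟨p, hp⟩ : ∃ p : ℕ → Fin n, p = fun a => q ((s.arr 8 0)^[a] t₀) := ⟨_, rfl⟩
  obtain ⟨hP, hinj, heq, hno, hD⟩ := hS.path hlt hft₀ hL hL' (p := p) (fun a _ => by rw [hp])
  replace hpath : ∀ a ≤ L + 1, t.arr 10 0 a = p a := fun a ha => by rw [hp]; exact hpath a ha
  replace r8 : t.reg 8 = p L := by rw [hp]; exact r8
  clear hp
  have hLn : L + 1 + 1 ≤ n :=
    le_of_injOn (q := p) fun a ha b hb => hinj a (by omega) b (by omega)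
  have s1 : IsSide M f₀ 1 t := h1.congr (arrs 1 (by decide)) (arrs 3 (by decide))
    (arrs 5 (by decide)) (ht.1 6 (by decide))
  have s2 : IsSide M g₀ 2 t := h2.congr (arrs 2 (by decide)) (arrs 4 (by decide))
    (arrs 6 (by decide)) (ht.1 7 (by decide))
  have t0 : t.reg 0 = n := (ht.1 0 (by decide)).trans hn
  have t1 : t.reg 1 = k := (ht.1 1 (by decide)).trans hk
  have t6 : t.reg 6 = s.reg 6 := ht.1 6 (by decide)
  have t7 : t.reg 7 = s.reg 7 := ht.1 7 (by decide)
  have tf : t.row n 1 0 = f := Store.row_congr (arrs 1 (by decide)) n 0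
  have tg : t.row n 2 0 = g := Store.row_congr (arrs 2 (by decide)) n 0
  clear arrs ht
  -- the element that replaces the first vertex of the path on side `2`
  have hA := hP.arc L (by omega) (by omega)
  obtain ⟨c, hc⟩ : ∃ c : Fin k, f (p (L + 1)) = c := ⟨⟨_, hA.lt⟩, rfl⟩
  have hfL : f (p L) ≠ c := hc ▸ hA.1
  have hgL : g (p L) ≠ c := heq L le_rfl ▸ hfL
  have hex := exists_arc_of_arc h1.valid h2.valid hfL hgL hc (fun e => hD (hc.trans e.symm)) hA
  refine .seq (.set (.seq ((Runs.source (y := p L) (c := c) (Or.inr rfl) (s2.setReg (by decide)) ?_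
    hN ?_ ?_ ?_ ?_).imp ?_)))
  · simpa [Store.setReg] using t0
  · simpa [Store.setReg] using r8
  · have : t.arr 1 0 (p (L + 1)) = f (p (L + 1)) := congrFun tf _
    simp [Store.setReg, Expr.val, r15, hpath, this, hc]
  · exact fun e => hgL ((congrFun tg _).symm.trans e)
  · have e1 : ∀ v, (t.setReg 10 v).row n 1 0 = f := fun _ => tf
    have e2 : ∀ v, (t.setReg 10 v).row n 2 0 = g := fun _ => tg
    rw [e1, e2]; exact hex
  have e1 : ∀ v, (t.setReg 10 v).row n 1 0 = f := fun _ => tf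
  have e2 : ∀ v, (t.setReg 10 v).row n 2 0 = g := fun _ => tg
  rw [e1, e2]
  rintro u hu ⟨hua, x', u9, hx1, hx2, hx3⟩
  have hua' : u.arr = t.arr := hua
  have hfg : f x' ≠ g x' := fun e => hx2 (e.trans hx1)
  have u15 : u.reg 15 = L + 1 := (hu.1 15 (by decide)).trans (by simpa [Store.setReg] using r15)
  have u0 : u.reg 0 = n := (hu.1 0 (by decide)).trans (by simpa [Store.setReg] using t0)
  have u1 : u.reg 1 = k := (hu.1 1 (by decide)).trans (by simpa [Store.setReg] using t1)
  have u6 : u.reg 6 = s.reg 6 := (hu.1 6 (by decide)).trans (by simpa [Store.setReg] using t6)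
  have u7 : u.reg 7 = s.reg 7 := (hu.1 7 (by decide)).trans (by simpa [Store.setReg] using t7)
  have us1 : IsSide M f₀ 1 u := s1.congr (by rw [hua']) (by rw [hua']) (by rw [hua'])
    (u6.trans t6.symm)
  have us2 : IsSide M g₀ 2 u := s2.congr (by rw [hua']) (by rw [hua']) (by rw [hua'])
    (u7.trans t7.symm)
  have uf : u.row n 1 0 = f := (Store.row_congr (by rw [hua']) n 0).trans tf
  have ug : u.row n 2 0 = g := (Store.row_congr (by rw [hua']) n 0).trans tg
  have uf' : (u.setReg 16 x').row n 1 0 = f := uf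
  clear hu
  refine .seq (.set (.seq ?_))
  simp only [Expr.val, u9]
  refine (Runs.walk (p := p) (L := L + 1) (Or.inl rfl) (us1.setReg (by decide)) ?_ ?_ hN ?_ ?_ ?_
    hinj).imp ?_
  · simpa [Store.setReg] using u0
  · simpa [Store.setReg] using u1
  · simpa [Store.setReg] using u15
  · simpa [Store.setReg, hua'] using hpath
  · rw [uf']; exact hP
  rw [uf']
  rintro w hw ⟨hw1, hw2, hw3⟩
  have w0 : w.reg 0 = n := (hw.1 0 (by decide)).trans (by simpa [Store.setReg] using u0)
  have w1 : w.reg 1 = k := (hw.1 1 (by decide)).trans (by simpa [Store.setReg] using u1)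
  have w15 : w.reg 15 = L + 1 := (hw.1 15 (by decide)).trans (by simpa [Store.setReg] using u15)
  have w16 : w.reg 16 = x' := (hw.1 16 (by decide)).trans (by simp [Store.setReg])
  have w7 : w.reg 7 = s.reg 7 := (hw.1 7 (by decide)).trans (by simpa [Store.setReg] using u7)
  have w6 : w.reg 6 = s.reg 6 + (L + 1) := by
    rw [← u6]; simpa [Store.setReg] using hw3
  have w10 : ∀ a ≤ L + 1, w.arr 10 0 a = p a := by
    rw [hw.2 10 (by decide)]; simpa [Store.setReg, hua'] using hpath
  have ws2 : IsSide M g₀ 2 w := us2.congr (hw.2 2 (by decide)) (hw.2 4 (by decide))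
    (hw.2 6 (by decide)) (w7.trans u7.symm)
  have wg : w.row n 2 0 = g := (Store.row_congr (hw.2 2 (by decide)) n 0).trans ug
  clear hw hw3
  refine .seq (.put ?_)
  simp only [Expr.val, w15, w16]
  have wg' : (w.setArr 10 0 (L + 1) x').row n 2 0 = g := by
    rw [← wg]; exact Store.row_congr (by simp [Store.setArr]) n 0
  refine (Runs.walk (s := w.setArr 10 0 (L + 1) x') (p := Function.update p (L + 1) x')
    (L := L + 1) (Or.inr rfl)
    (ws2.congr (by simp [Store.setArr]) (by simp [Store.setArr]) (by simp [Store.setArr]) rfl)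
    w0 w1 hN w15 ?_ ?_ (injOn_update heq hinj hfg)).imp ?_
  · intro a ha
    by_cases hae : a = L + 1
    · subst hae; simp [Store.setArr]
    · rw [Function.update_of_ne hae, ← w10 a ha]
      simp [Store.setArr, hae]
  · rw [wg']
    exact hP.update h1.valid h2.valid heq hno hfg hx3
  rw [wg']
  rintro v hv ⟨hv1, hv2, hv3⟩
  have v6 : v.reg 6 = s.reg 6 + (L + 1) := (hv.1 6 (by decide)).trans w6
  have v1 : v.arr 1 = w.arr 1 := (hv.2 1 (by decide)).trans (by simp [Store.setArr])
  have v3 : v.arr 3 = w.arr 3 := (hv.2 3 (by decide)).trans (by simp [Store.setArr])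
  have v5 : v.arr 5 = w.arr 5 := (hv.2 5 (by decide)).trans (by simp [Store.setArr])
  have v7 : v.reg 7 = s.reg 7 + (L + 1) := by
    rw [← w7]; exact hv3
  refine ⟨hw1.congr v1 v3 v5 (v6.trans w6.symm), hv1, ?_, by omega, by omega⟩
  refine discrepancy_shift_lt hD hA.lt heq hinj (hx1.trans hc.symm) hfg ?_ hv2
  rw [Store.row_congr v1]
  exact hw2

/-- Bring the two sides closer to each other, or set the status in register `5`: to `1` if they are
equal, and to `2` if there is no sequence of steps between them. -/
def Prog.iteration : Prog :=
  .seq .target <|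
  .ite (.lt (.reg 8) (.reg 0))
    (.seq (.set 10 (.cell 2 (.reg 8))) <|
      .seq (.source 1 2) <|
      .exchange 1) <|
    .seq .seed <|
    .seq (.set 13 (.reg 11)) <|
    .ite (.eq (.reg 13) (.lit 0)) (.set 5 (.lit 1)) <|
      .seq .explore <|
      .seq .findFree <|
      .ite (.lt (.reg 14) (.reg 11)) .augment (.set 5 (.lit 2))

/-- The invariant of the main loop. The sequences are short since every iteration adds at most `n`
steps to each of them. -/
structure IsState (M : Fin k → Matroid (Fin n)) (f₀ g₀ : Fin n → ℕ) (s : Store) : Prop where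
  n_eq : s.reg 0 = n
  k_eq : s.reg 1 = k
  side₁ : IsSide M f₀ 1 s
  side₂ : IsSide M g₀ 2 s
  len₁ : s.reg 6 + n * discrepancy k (s.row n 1 0) (s.row n 2 0) ≤ n * n
  len₂ : s.reg 7 + n * discrepancy k (s.row n 1 0) (s.row n 2 0) ≤ n * n
  status : s.reg 5 = 0 ∨ (s.reg 5 = 1 ∧ s.row n 1 0 = s.row n 2 0) ∨
    (s.reg 5 = 2 ∧ ¬ Relation.ReflTransGen (Step M) (classes k (s.row n 1 0))
      (classes k (s.row n 2 0)))

theorem add_mul_le_of_lt {l l' m a b c : ℕ} (h : l + m * a ≤ c) (hl : l' ≤ l + m) (hb : b < a) :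
    l' + m * b ≤ c := by
  have := Nat.mul_le_mul_left m (Nat.succ_le_of_lt hb)
  rw [Nat.mul_succ] at this
  omega

theorem Runs.iteration (h : IsState M f₀ g₀ s) (h0 : 0 < n) (hN : n < N) (hs : s.reg 5 = 0) :
    Runs (basisOracle M) N Prog.iteration s fun t => IsState M f₀ g₀ t ∧ (t.reg 5 ≠ 0 ∨
      discrepancy k (t.row n 1 0) (t.row n 2 0) <
        discrepancy k (s.row n 1 0) (s.row n 2 0)) := by
  refine .seq ((Runs.target h.n_eq h.k_eq hN).imp fun t ht hP => ?_)
  have harr : t.arr = s.arr := funext fun a => ht.2 a (by simp [Prog.target, Prog.for, Prog.arrs])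
  have t0 : t.reg 0 = n := (ht.1 0 (by decide)).trans h.n_eq
  have t1 : t.reg 1 = k := (ht.1 1 (by decide)).trans h.k_eq
  have t5 : t.reg 5 = 0 := (ht.1 5 (by decide)).trans hs
  have t6 : t.reg 6 = s.reg 6 := ht.1 6 (by decide)
  have t7 : t.reg 7 = s.reg 7 := ht.1 7 (by decide)
  have s1 : IsSide M f₀ 1 t := h.side₁.congr (by rw [harr]) (by rw [harr]) (by rw [harr]) t6
  have s2 : IsSide M g₀ 2 t := h.side₂.congr (by rw [harr]) (by rw [harr]) (by rw [harr]) t7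
  have tf : t.row n 1 0 = s.row n 1 0 := Store.row_congr (by rw [harr]) n 0
  have tg : t.row n 2 0 = s.row n 2 0 := Store.row_congr (by rw [harr]) n 0
  have len1 := h.len₁
  have len2 := h.len₂
  rw [← tf, ← tg] at hP len1 len2 ⊢
  rw [← t6] at len1
  rw [← t7] at len2
  clear h hs harr ht t6 t7 tf tg
  refine .ite (fun hb => ?_) (fun hb => ?_)
  · -- some element is free on side `1` only
    simp only [Test.holds, Expr.val, t0] at hb
    obtain ⟨y, t8, hfy, hgy⟩ := hP.resolve_left (by omega)
    obtain ⟨c, hc⟩ : ∃ c : Fin k, t.row n 2 0 y = c :=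
      ⟨⟨_, lt_of_le_of_ne (s2.valid.le y) hgy⟩, rfl⟩
    have hfc : t.row n 1 0 y ≠ c := by rw [hfy]; exact c.2.ne'
    refine .seq (.set (.seq ((Runs.source (y := y) (c := c) (Or.inl rfl) (s1.setReg (by decide)) ?_
      hN ?_ ?_ hfc (exists_arc_of_label s1.valid s2.valid hfc hc)).imp ?_)))
    · simpa [Store.setReg] using t0
    · simpa [Store.setReg] using t8
    · have : t.arr 2 0 y = c := hc
      simp [Store.setReg, Expr.val, t8, this]
    rintro u hu ⟨hua, x, u9, hx1, hx2, hx3⟩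
    have hua' : u.arr = t.arr := hua
    have uf : u.row n 1 0 = t.row n 1 0 := Store.row_congr (by rw [hua']) n 0
    have ug : u.row n 2 0 = t.row n 2 0 := Store.row_congr (by rw [hua']) n 0
    have hreg : ∀ r, r ∉ [2, 4, 9, 10] → u.reg r = t.reg r := by
      intro r hr
      simp only [List.mem_cons, not_or] at hr
      refine (hu.1 r ?_).trans ?_
      · simp [Prog.source, Prog.for, Prog.regs, Prog.query, hr]
      · simp [Store.setReg, hr]
    have us1 : IsSide M f₀ 1 u := s1.congr (by rw [hua']) (by rw [hua']) (by rw [hua'])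
      (hreg 6 (by decide))
    refine (Runs.exchange (x := x) (y := y) (Or.inl rfl) us1 ((hreg 0 (by decide)).trans t0) hN
      ((hreg 1 (by decide)).trans t1) u9 ((hreg 8 (by decide)).trans t8) (by rw [uf]; exact hx3)
      (by rw [uf]; exact hfy)).imp ?_
    rintro v hv ⟨hv1, hv2, hv3⟩
    rw [uf] at hv2
    have hx1' : t.row n 1 0 x = t.row n 2 0 y := hx1.trans hc.symm
    have vg : v.row n 2 0 = t.row n 2 0 := (Store.row_congr (hv.2 2 (by decide)) n 0).trans ug
    have hlt : discrepancy k (v.row n 1 0) (v.row n 2 0) <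
        discrepancy k (t.row n 1 0) (t.row n 2 0) := by
      rw [hv2, vg]
      exact discrepancy_exchange_lt hx3 hx1' fun e => hx2 (e.symm.trans hx1)
    have v6 : v.reg 6 = t.reg 6 + 1 := by
      rw [← hreg 6 (by decide)]; exact hv3
    have v7 : v.reg 7 = t.reg 7 := (hv.1 7 (by decide)).trans (hreg 7 (by decide))
    refine ⟨⟨(hv.1 0 (by decide)).trans ((hreg 0 (by decide)).trans t0),
      (hv.1 1 (by decide)).trans ((hreg 1 (by decide)).trans t1), hv1,
      s2.congr ((hv.2 2 (by decide)).trans (by rw [hua']))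
        ((hv.2 4 (by decide)).trans (by rw [hua'])) ((hv.2 6 (by decide)).trans (by rw [hua'])) v7,
      add_mul_le_of_lt len1 (by omega) hlt, add_mul_le_of_lt len2 (by omega) hlt,
      Or.inl ((hv.1 5 (by decide)).trans ((hreg 5 (by decide)).trans t5))⟩, Or.inr hlt⟩
  · simp only [Test.holds, Expr.val, t0] at hb
    have hfree : ∀ y, t.row n 1 0 y = k → t.row n 2 0 y = k := by
      rcases hP with ⟨-, h⟩ | ⟨y, h, -⟩
      · exact h
      · have := y.2
        omega
    clear hP
    -- a change of registers that sets the status preserves the invariant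
    have hdone : ∀ u : Store, u.reg 0 = n → u.reg 1 = k → u.reg 6 = t.reg 6 → u.reg 7 = t.reg 7 →
        (∀ a, 1 ≤ a → a ≤ 6 → u.arr a = t.arr a) →
        ((u.reg 5 = 1 ∧ t.row n 1 0 = t.row n 2 0) ∨
          (u.reg 5 = 2 ∧ ¬ Relation.ReflTransGen (Step M) (classes k (t.row n 1 0))
            (classes k (t.row n 2 0)))) →
        IsState M f₀ g₀ u ∧ (u.reg 5 ≠ 0 ∨ discrepancy k (u.row n 1 0) (u.row n 2 0) <
          discrepancy k (t.row n 1 0) (t.row n 2 0)) := by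
      intro u u0 u1 u6 u7 ua us
      have uf : u.row n 1 0 = t.row n 1 0 := Store.row_congr (ua 1 (by omega) (by omega)) n 0
      have ug : u.row n 2 0 = t.row n 2 0 := Store.row_congr (ua 2 (by omega) (by omega)) n 0
      refine ⟨⟨u0, u1, s1.congr (ua 1 (by omega) (by omega)) (ua 3 (by omega) (by omega))
        (ua 5 (by omega) (by omega)) u6, s2.congr (ua 2 (by omega) (by omega))
        (ua 4 (by omega) (by omega)) (ua 6 (by omega) (by omega)) u7, ?_, ?_, ?_⟩, ?_⟩
      · rw [uf, ug, u6]; exact len1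
      · rw [uf, ug, u7]; exact len2
      · rw [uf, ug]; exact Or.inr us
      · left
        rcases us with us | us <;> rw [us.1] <;> decide
    refine .seq ((Runs.seed (M := M) t0 h0 hN).imp ?_)
    rintro u hu ⟨q, hq, hS⟩
    have ua : ∀ a, 1 ≤ a → a ≤ 6 → u.arr a = t.arr a := by
      intro a h1 h2
      refine hu.2 a ?_
      simp only [Prog.seed, Prog.for, Prog.arrs, List.append_nil, List.nil_append, List.mem_cons,
        List.mem_append, List.not_mem_nil, or_false, not_or]
      omega
    have u0 : u.reg 0 = n := (hu.1 0 (by decide)).trans t0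
    have u1 : u.reg 1 = k := (hu.1 1 (by decide)).trans t1
    have u5 : u.reg 5 = 0 := (hu.1 5 (by decide)).trans t5
    have u6 : u.reg 6 = t.reg 6 := hu.1 6 (by decide)
    have u7 : u.reg 7 = t.reg 7 := hu.1 7 (by decide)
    clear hu
    refine .seq (.set ?_)
    simp only [Expr.val]
    refine .ite (fun hb => .set ?_) (fun hb => .seq ?_)
    · -- the two sides are equal
      simp only [Test.holds, Expr.val, Store.setReg, Function.update_self] at hb
      refine hdone _ (by simpa [Store.setReg] using u0) (by simpa [Store.setReg] using u1)
        (by simpa [Store.setReg] using u6) (by simpa [Store.setReg] using u7) ua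
        (Or.inl ⟨by simp [Store.setReg, Expr.val], funext fun x => ?_⟩)
      by_contra hc
      obtain ⟨i, hi, -⟩ := hS.seeded x hc
      omega
    simp only [Test.holds, Expr.val, Store.setReg, Function.update_self] at hb
    have us1 : IsSide M f₀ 1 (u.setReg 13 (u.reg 11)) :=
      (s1.congr (ua 1 (by omega) (by omega)) (ua 3 (by omega) (by omega))
        (ua 5 (by omega) (by omega)) u6).setReg (by decide)
    refine (Runs.explore us1 (Store.row_congr (ua 1 (by omega) (by omega)) n 0)
      (by simpa [Store.setReg] using u0) hN (hq.congr rfl rfl (by simp [Store.setReg]))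
      (by simpa [Store.setReg] using hS)).imp ?_
    rintro w hw ⟨q', hq', hS', w5⟩
    have wa : ∀ a, 1 ≤ a → a ≤ 6 → w.arr a = t.arr a := by
      intro a h1 h2
      by_cases h5 : a = 5
      · subst h5
        exact w5.trans (ua 5 h1 h2)
      · refine (hw.2 a ?_).trans (ua a h1 h2)
        simp only [Prog.explore, Prog.scan, Prog.query, Prog.for, Prog.arrs, List.append_nil,
          List.nil_append, List.mem_cons, List.mem_append, List.not_mem_nil, or_false, not_or]
        omega
    have w0 : w.reg 0 = n := (hw.1 0 (by decide)).trans (by simpa [Store.setReg] using u0)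
    have w1 : w.reg 1 = k := (hw.1 1 (by decide)).trans (by simpa [Store.setReg] using u1)
    have w5' : w.reg 5 = 0 := (hw.1 5 (by decide)).trans (by simpa [Store.setReg] using u5)
    have w6 : w.reg 6 = t.reg 6 := (hw.1 6 (by decide)).trans (by simpa [Store.setReg] using u6)
    have w7 : w.reg 7 = t.reg 7 := (hw.1 7 (by decide)).trans (by simpa [Store.setReg] using u7)
    have w13 : w.reg 13 = u.reg 11 := (hw.1 13 (by decide)).trans (by simp [Store.setReg])
    have wf : w.row n 1 0 = t.row n 1 0 := Store.row_congr (wa 1 (by omega) (by omega)) n 0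
    have htail := hS'.tail_le
    clear hw us1 ua u0 u1 u5 u6 u7
    refine .seq ((Runs.findFree wf w1 hq' (by omega)).imp ?_)
    rintro z hz hfound
    have za : ∀ a, z.arr a = w.arr a := fun a =>
      hz.2 a (by simp [Prog.findFree, Prog.for, Prog.arrs])
    have z11 : z.reg 11 = w.reg 11 := hz.1 11 (by decide)
    have z0 : z.reg 0 = n := (hz.1 0 (by decide)).trans w0
    have z1 : z.reg 1 = k := (hz.1 1 (by decide)).trans w1
    have z5 : z.reg 5 = 0 := (hz.1 5 (by decide)).trans w5'
    have z6 : z.reg 6 = t.reg 6 := (hz.1 6 (by decide)).trans w6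
    have z7 : z.reg 7 = t.reg 7 := (hz.1 7 (by decide)).trans w7
    have z13 : z.reg 13 = u.reg 11 := (hz.1 13 (by decide)).trans w13
    have zq : IsQueue q' z := hq'.congr (za 7) (za 9) z11
    have zf : z.row n 1 0 = t.row n 1 0 := (Store.row_congr (za 1) n 0).trans wf
    have zg : z.row n 2 0 = t.row n 2 0 := (Store.row_congr (za 2) n 0).trans
      (Store.row_congr (wa 2 (by omega) (by omega)) n 0)
    have za' : ∀ a, 1 ≤ a → a ≤ 6 → z.arr a = t.arr a := fun a h1 h2 => (za a).trans (wa a h1 h2)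
    have zs1 : IsSide M f₀ 1 z := s1.congr (za' 1 (by omega) (by omega))
      (za' 3 (by omega) (by omega)) (za' 5 (by omega) (by omega)) z6
    have zs2 : IsSide M g₀ 2 z := s2.congr (za' 2 (by omega) (by omega))
      (za' 4 (by omega) (by omega)) (za' 6 (by omega) (by omega)) z7
    clear hz
    refine .ite (fun hb' => ?_) (fun hb' => .set ?_)
    · simp only [Test.holds, Expr.val, z11] at hb'
      rcases hfound with ⟨h1, -⟩ | ⟨h1, h2⟩
      · omega
      refine (Runs.augment (head := w.reg 11) (i := 0) zs1 zs2 z0 z1 hN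
        (by rw [zf, zg]; exact hfree) zq ?_ z13 rfl (by rw [z11]; exact h1)
        (by rw [zf]; exact h2)).imp ?_
      · rw [zf, zg, za, z11]
        exact hS'
      rw [zf, zg, z6, z7]
      rintro v hv ⟨hv1, hv2, hv3, hv4, hv5⟩
      exact ⟨⟨(hv.1 0 (by decide)).trans z0, (hv.1 1 (by decide)).trans z1, hv1, hv2,
        add_mul_le_of_lt len1 hv4 hv3, add_mul_le_of_lt len2 hv5 hv3,
        Or.inl ((hv.1 5 (by decide)).trans z5)⟩, Or.inr hv3⟩
    · simp only [Test.holds, Expr.val, z11] at hb'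
      rcases hfound with ⟨-, h2⟩ | ⟨h1, -⟩
      · exact hdone _ (by simpa [Store.setReg] using z0) (by simpa [Store.setReg] using z1)
          (by simpa [Store.setReg] using z6) (by simpa [Store.setReg] using z7) za'
          (Or.inr ⟨by simp [Store.setReg, Expr.val],
            hS'.not_reflTransGen (by omega) s1.valid h2⟩)
      · omega

end Iteration

/-! ### The whole program -/

section Main

variable {n k : ℕ} {M : Fin k → Matroid (Fin n)} {f₀ g₀ : Fin n → ℕ} {s : Store} {N σ : ℕ}
  {O : ℕ → Set ℕ → Prop}

/-- Initialize side `σ`. -/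
def Prog.setup (σ : ℕ) : Prog :=
  .seq (.for 2 0 (.put (σ + 4) (.cell σ (.reg 2)) (.reg 2) (.lit 1))) (.record σ)

theorem Runs.setup (hn : s.reg 0 = n) (hN : n < N)
    (hf : IsBaseLabelling M f₀) (hf₀ : s.row n σ 0 = f₀) (h4 : ∀ i j, s.arr (σ + 4) i j = 0)
    (h5 : s.reg (σ + 5) = 0) : Runs O N (Prog.setup σ) s (IsSide M f₀ σ) := by
  refine .seq (Runs.for (m := n) (fun j t => ∀ c (x : Fin n), t.arr (σ + 4) c x =
    if s.arr σ 0 x = c ∧ (x : ℕ) < j then 1 else 0) hn hN (by simp [Prog.regs])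
    (by simp [Prog.for, Prog.regs]) (by simp [Store.setReg, h4]) ?_ ?_)
  · rintro j hj t ht hr h1
    have a1 : t.arr σ = s.arr σ := ht.2 σ (by simp [Prog.for, Prog.arrs])
    refine .put fun c x => ?_
    simp only [Store.setReg, Store.setArr, Expr.val, hr, a1, true_and, h1]
    by_cases h2 : (x : ℕ) = j
    · subst h2
      by_cases h3 : c = s.arr σ 0 x
      · simp [h3]
      · simp [h3, Ne.symm h3]
    · have h3 : (x : ℕ) < j + 1 ↔ (x : ℕ) < j := by omega
      simp [h2, h3]
  · rintro t ht h1
    have t5 : t.reg (σ + 5) = 0 := (ht.1 _ (by simp [Prog.for, Prog.regs])).trans h5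
    have a1 : t.arr σ = s.arr σ := ht.2 σ (by simp [Prog.for, Prog.arrs])
    have t0 : t.reg 0 = n := (ht.1 0 (by simp [Prog.for, Prog.regs])).trans hn
    refine (Runs.record t0 hN).imp ?_
    rintro u hu ⟨h2, -⟩
    have u5 : u.reg (σ + 5) = 0 := (hu.1 _ (by simp [Prog.record, Prog.for, Prog.regs])).trans t5
    have u1 : u.arr σ = s.arr σ := (hu.2 _ (by simp [Prog.record, Prog.for, Prog.arrs])).trans a1
    have u4 : u.arr (σ + 4) = t.arr (σ + 4) :=
      hu.2 _ (by simp [Prog.record, Prog.for, Prog.arrs])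
    have hrow : u.row n σ 0 = f₀ := (Store.row_congr u1 n 0).trans hf₀
    rw [t5, Store.row_congr a1, hf₀] at h2
    refine ⟨hrow ▸ hf, fun c x => ?_, h2, by rw [u5, h2, hrow], by rw [u5]; simp⟩
    rw [u4, h1, u1]
    simp

/-- Prepare both sides, and iterate until the status is set. -/
def Prog.search : Prog :=
  .seq (.setup 1) <| .seq (.setup 2) <| .loop (.eq (.reg 5) (.lit 0)) .iteration

theorem Runs.search {B B' : Fin k → Set (Fin n)} (hB : Feasible M B) (hB' : Feasible M B')
    (h0 : 0 < n) (hN : n + 1 < N) :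
    Runs (basisOracle M) N Prog.search (initStore M B B') fun t =>
      IsState M (fun x => label B x) (fun x => label B' x) t ∧ t.reg 5 ≠ 0 := by
  refine .seq ((Runs.setup (f₀ := fun x => label B x) (n := n) rfl (by omega)
    (isBaseLabelling_label hB) (funext fun x => ?_) (fun i j => rfl) rfl).imp ?_)
  · simp [Store.row, initStore]
  rintro t ht h1
  refine .seq ((Runs.setup (f₀ := fun x => label B' x) (n := n)
    (ht.1 0 (by decide)) (by omega) (isBaseLabelling_label hB') (funext fun x => ?_) (fun i j => ?_) ?_).imp ?_)
  · rw [Store.row, ht.2 2 (by decide)]; simp [initStore]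
  · rw [ht.2 6 (by decide)]; simp [initStore]
  · rw [ht.1 7 (by decide)]; simp [initStore]
  rintro u hu h2
  have u5 : u.reg 5 = 0 := (hu.1 5 (by decide)).trans (ht.1 5 (by decide))
  have u6 : u.reg 6 = 0 := (hu.1 6 (by decide)).trans (ht.1 6 (by decide))
  have u7 : u.reg 7 = 0 := (hu.1 7 (by decide)).trans (ht.1 7 (by decide))
  have u0 : u.reg 0 = n := (hu.1 0 (by decide)).trans (ht.1 0 (by decide))
  have u1 : u.reg 1 = k := (hu.1 1 (by decide)).trans (ht.1 1 (by decide))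
  have hle : n * discrepancy k (u.row n 1 0) (u.row n 2 0) ≤ n * n :=
    Nat.mul_le_mul_left n discrepancy_le
  refine .loop (IsState M (fun x => label B x) (fun x => label B' x)) (fun t =>
    if t.reg 5 = 0 then discrepancy k (t.row n 1 0) (t.row n 2 0) + 1 else 0) ?_ ?_ ?_ ?_
  · exact ⟨u0, u1, h1.congr (hu.2 1 (by decide)) (hu.2 3 (by decide)) (hu.2 5 (by decide))
      (hu.1 6 (by decide)), h2, by omega, by omega, Or.inl u5⟩
  · rw [if_pos u5]
    have : discrepancy k (u.row n 1 0) (u.row n 2 0) ≤ n := discrepancy_le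
    omega
  · rintro v - hv hb
    have v5 : v.reg 5 = 0 := hb
    refine (Runs.iteration hv h0 (by omega) v5).imp ?_
    rintro w - ⟨h3, h4⟩
    refine ⟨h3, ?_⟩
    rw [if_pos v5]
    split
    · rename_i w5
      have := h4.resolve_left (not_not.2 w5)
      omega
    · omega
  · rintro v - hv hb
    exact ⟨hv, hb⟩

/-- Store the predecessor of `t + 1` in the cell `t + 1` of array `11`. -/
def Prog.predTable : Prog := .for 3 7 (.put 11 (.lit 0) (.succ (.reg 3)) (.reg 3))

theorem Runs.predTable (hN : s.reg 7 < N) :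
    Runs O N Prog.predTable s fun t => ∀ i < s.reg 7, t.arr 11 0 (i + 1) = i := by
  refine Runs.for (m := s.reg 7) (fun j t => ∀ i < j, t.arr 11 0 (i + 1) = i) rfl hN (by decide)
    (by decide) (by simp) ?_ (fun t _ h => h)
  rintro j hj t ht hr h1
  refine .put fun i hi => ?_
  simp only [Store.setReg, Store.setArr, Expr.val, hr, true_and]
  split
  · omega
  · exact h1 i (by omega)

/-- Step back in the sequence of side `2`, and append the labelling found there to the sequence of
side `1`. -/
def Prog.copyBack : Prog :=
  .seq (.set 7 (.cell 11 (.reg 7))) <|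
  .seq (.set 6 (.succ (.reg 6))) <|
  .for 2 0 (.put 3 (.reg 6) (.reg 2) (.get 4 (.reg 7) (.reg 2)))

theorem Runs.copyBack (hn : s.reg 0 = n) (hN : n < N) :
    Runs O N Prog.copyBack s fun t => t.reg 7 = s.arr 11 0 (s.reg 7) ∧ t.reg 6 = s.reg 6 + 1 ∧
      t.row n 3 (s.reg 6 + 1) = s.row n 4 (s.arr 11 0 (s.reg 7)) ∧
      ∀ i ≤ s.reg 6, t.row n 3 i = s.row n 3 i := by
  refine .seq (.set (.seq (.set (Runs.for (m := n) (fun j t => (∀ x : Fin n, (x : ℕ) < j →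
    t.arr 3 (s.reg 6 + 1) x = s.arr 4 (s.arr 11 0 (s.reg 7)) x) ∧
    ∀ i ≤ s.reg 6, t.row n 3 i = s.row n 3 i) ?_ hN (by decide) (by decide) ?_ ?_ ?_))))
  · simpa [Store.setReg] using hn
  · exact ⟨by simp, fun _ _ => rfl⟩
  · rintro j hj t ht hr ⟨h1, h2⟩
    have e7 : t.reg 7 = s.arr 11 0 (s.reg 7) :=
      (ht.1 7 (by decide)).trans (by simp [Store.setReg, Expr.val])
    have e6 : t.reg 6 = s.reg 6 + 1 :=
      (ht.1 6 (by decide)).trans (by simp [Store.setReg, Expr.val])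
    have a4 : t.arr 4 = s.arr 4 := ht.2 4 (by decide)
    refine .put ⟨fun x hx => ?_, fun i hi => funext fun x => ?_⟩
    · simp only [Store.setReg, Store.setArr, Expr.val, hr, e6, e7, a4, true_and]
      split
      · rename_i e; rw [e]
      · exact h1 x (by omega)
    · have hne : i ≠ s.reg 6 + 1 := by omega
      rw [← h2 i hi]
      simp [Store.row, Store.setReg, Store.setArr, Expr.val, e6, hne]
  · rintro t ht ⟨h1, h2⟩
    exact ⟨(ht.1 7 (by decide)).trans (by simp [Store.setReg, Expr.val]),
      (ht.1 6 (by decide)).trans (by simp [Store.setReg, Expr.val]),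
      funext fun x => h1 x x.2, h2⟩

/-- Output the sequence of side `1`, followed by the reversed sequence of side `2`. -/
def Prog.output : Prog :=
  .seq .predTable <|
  .seq (.loop (.not (.eq (.reg 7) (.lit 0))) .copyBack) <|
  .seq (.set 1 (.reg 6)) (.set 0 (.lit 1))

/-- The main loop of `output` makes up to `n * n` iterations, so its time bound is not covered by
the uniform bound of `Runs`. -/
theorem exec_output (hn : s.reg 0 = n) (h7 : s.reg 7 ≤ n * n)
    (hjoin : s.row n 3 (s.reg 6) = s.row n 4 (s.reg 7)) :
    ∃ t T Q, Exec O Prog.output s t T Q ∧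
      T ≤ (Prog.predTable.bound 1 + Prog.copyBack.bound 1 + 10) * (n + 1) ^ 3 ∧
      t.reg 0 = 1 ∧ t.reg 1 = s.reg 6 + s.reg 7 ∧
      (∀ i ≤ s.reg 6, t.row n 3 i = s.row n 3 i) ∧
      ∀ i ≤ s.reg 7, t.row n 3 (s.reg 6 + s.reg 7 - i) = s.row n 4 i := by
  obtain ⟨u, T, Q, hu, hT, hpred⟩ :=
    Runs.predTable (O := O) (s := s) (N := n * n + 1) (by omega)
  have hu' := hu.agree
  have u7 : u.reg 7 = s.reg 7 := hu'.1 7 (by decide)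
  have u6 : u.reg 6 = s.reg 6 := hu'.1 6 (by decide)
  have u0 : u.reg 0 = n := (hu'.1 0 (by decide)).trans hn
  have u3 : ∀ i, u.row n 3 i = s.row n 3 i := Store.row_congr (hu'.2 3 (by decide)) n
  have u4 : ∀ i, u.row n 4 i = s.row n 4 i := Store.row_congr (hu'.2 4 (by decide)) n
  obtain ⟨v, T', Q', hv, hT', ⟨h1, h2, h3⟩, hb⟩ := Runs.loop_exec (O := O) (N := n + 1)
    (p := Prog.copyBack) (s := u)
    (b := .not (.eq (.reg 7) (.lit 0))) (fun t =>
      (s.reg 6 ≤ t.reg 6 ∧ t.reg 6 + t.reg 7 = s.reg 6 + s.reg 7) ∧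
      (∀ i ≤ s.reg 6, t.row n 3 i = s.row n 3 i) ∧ ∀ i ≤ s.reg 7, t.reg 7 ≤ i →
        t.row n 3 (s.reg 6 + s.reg 7 - i) = s.row n 4 i) (fun t => t.reg 7) (by
      rintro t ht ⟨h1, h2, h3⟩ hb
      simp only [Test.holds, Expr.val] at hb
      refine (Runs.copyBack ((ht.1 0 (by decide)).trans u0) (by omega)).imp ?_
      rintro t' - ⟨h4, h5, h6, h7⟩
      obtain ⟨j, hj⟩ := Nat.exists_eq_succ_of_ne_zero hb
      have a11 : t.arr 11 0 (t.reg 7) = j := by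
        rw [ht.2 11 (by decide), hj]
        exact hpred j (by omega)
      have a4 : ∀ i, t.row n 4 i = s.row n 4 i := fun i =>
        (Store.row_congr (ht.2 4 (by decide)) n i).trans (u4 i)
      rw [a11] at h4 h6
      refine ⟨⟨by omega, fun i hi => ?_, fun i hi hji => ?_⟩, by omega⟩
      · rw [h7 i (by omega), h2 i hi]
      · rcases hji.lt_or_eq with h | h
        · rw [h7 _ (by omega)]
          exact h3 i hi (by omega)
        · obtain rfl : j = i := by omega
          rw [show s.reg 6 + s.reg 7 - j = t.reg 6 + 1 by omega, h6, a4]) (n * n) u .refl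
    ⟨by omega, fun i _ => u3 i, fun i hi hui => by
      obtain rfl : i = s.reg 7 := by omega
      rw [Nat.add_sub_cancel, u3, hjoin]⟩ (by omega)
  simp only [Test.holds, Expr.val, not_not] at hb
  refine ⟨_, _, _, .seq hu (.seq hv (.seq (.set v 1 (.reg 6)) (.set _ 0 (.lit 1)))), ?_, ?_, ?_,
    ?_, ?_⟩
  · have b1 := Prog.predTable.bound_le (N := n * n + 1) (by omega)
    have b2 := Prog.copyBack.bound_le (N := n + 1) (by omega)
    have d1 : Prog.predTable.depth = 1 := rfl
    have d2 : Prog.copyBack.depth = 1 := rfl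
    rw [d1, pow_one] at b1
    rw [d2, pow_one] at b2
    have e1 : n * n + 1 ≤ (n + 1) ^ 3 := by nlinarith [Nat.zero_le n, Nat.zero_le (n ^ 3)]
    have e2 : (n * n + 1) * (n + 1) ≤ (n + 1) ^ 3 := by
      nlinarith [Nat.zero_le n, Nat.zero_le (n ^ 3)]
    have e3 : 1 ≤ (n + 1) ^ 3 := Nat.one_le_pow _ _ (by omega)
    simp only [Expr.cost]
    have hc : Test.cost (.not (.eq (.reg 7) (.lit 0))) = 4 := rfl
    rw [hc] at hT'
    calc T + (T' + (1 + 1 + (1 + 1)))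
        ≤ Prog.predTable.bound 1 * (n * n + 1) +
          ((n * n + 1) * (4 + Prog.copyBack.bound 1 * (n + 1)) + 4) := by
          refine Nat.add_le_add (hT.trans b1) (Nat.add_le_add (hT'.trans ?_) le_rfl)
          exact Nat.mul_le_mul_left _ (Nat.add_le_add_left b2 _)
      _ = Prog.predTable.bound 1 * (n * n + 1) + 4 * (n * n + 1) +
          Prog.copyBack.bound 1 * ((n * n + 1) * (n + 1)) + 4 := by ring
      _ ≤ Prog.predTable.bound 1 * (n + 1) ^ 3 + 4 * (n + 1) ^ 3 +
          Prog.copyBack.bound 1 * (n + 1) ^ 3 + 4 * (n + 1) ^ 3 := by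
          gcongr
          omega
      _ ≤ _ := by nlinarith
  · simp [Store.setReg, Expr.val]
  · simp [Store.setReg, Expr.val]
    omega
  · exact h2
  · exact fun i hi => h3 i hi (by omega)

/-- The decision procedure. The case of an empty ground set is treated separately, since no oracle
call is allowed there. -/
def Prog.reconfigure : Prog :=
  .ite (.eq (.reg 0) (.lit 0)) (.seq (.set 0 (.lit 1)) (.set 1 (.lit 0))) <|
    .seq .search <|
    .ite (.eq (.reg 5) (.lit 1)) .output (.set 0 (.lit 0))

end Main

theorem theorem1 :
    ∃ (p : Prog) (C : ℕ),
      ∀ (n k : ℕ) (M : Fin k → Matroid (Fin n)) (B B' : Fin k → Set (Fin n)),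
        Feasible M B → Feasible M B' →
        ∃ (s : Store) (T Q : ℕ),
          Exec (basisOracle M) p (initStore M B B') s T Q ∧
          T ≤ C * (n + 1) ^ 3 ∧
          Q ≤ C * n ^ 3 ∧
          (¬ Reconfigurable M B B' → s.reg 0 = 0) ∧
          (Reconfigurable M B B' →
            s.reg 0 = 1 ∧
            ∃ (ℓ : ℕ) (S : ℕ → Fin k → Set (Fin n)),
              IsReconfSeq M B B' ℓ S ∧ ℓ ≤ C * n ^ 2 ∧ Outputs s ℓ S) := by
  obtain ⟨c, hc⟩ : ∃ c, c = 8 * Prog.search.bound 1 +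
    (Prog.predTable.bound 1 + Prog.copyBack.bound 1 + 10) + 10 := ⟨_, rfl⟩
  refine ⟨.reconfigure, 8 * c, fun n k M B B' hB hB' => ?_⟩
  rcases Nat.eq_zero_or_pos n with rfl | h0
  · have hBB' : B = B' := funext fun i => Set.ext fun x => x.elim0
    subst hBB'
    refine ⟨_, _, _, .ite_true (by simp [Test.holds, Expr.val, initStore])
      (.seq (.set _ 0 (.lit 1)) (.set _ 1 (.lit 0))), ?_, by simp, ?_, ?_⟩
    · simp [Test.cost, Expr.cost]; omega
    · intro h
      exact (h ⟨0, fun _ => B, rfl, rfl, fun _ _ => hB, by simp⟩).elim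
    · intro _
      refine ⟨by simp [Store.setReg, Expr.val], 0, fun _ => B, ⟨rfl, rfl, fun _ _ => hB, by simp⟩,
        by simp, by simp [Store.setReg, Expr.val], by simp⟩
  -- a call is a step, so it suffices to bound the time
  suffices h : ∃ (s : Store) (T Q : ℕ),
      Exec (basisOracle M) .reconfigure (initStore M B B') s T Q ∧ T ≤ c * (n + 1) ^ 3 ∧
      (¬ Reconfigurable M B B' → s.reg 0 = 0) ∧
      (Reconfigurable M B B' → s.reg 0 = 1 ∧ ∃ (ℓ : ℕ) (S : ℕ → Fin k → Set (Fin n)),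
        IsReconfSeq M B B' ℓ S ∧ ℓ ≤ 2 * n ^ 2 ∧ Outputs s ℓ S) by
    obtain ⟨s, T, Q, h1, h2, h3, h4⟩ := h
    have hpow : (n + 1) ^ 3 ≤ 8 * n ^ 3 := by
      calc (n + 1) ^ 3 ≤ (2 * n) ^ 3 := by gcongr; omega
        _ = 8 * n ^ 3 := by ring
    refine ⟨s, T, Q, h1, h2.trans (Nat.mul_le_mul_right _ (by omega)), ?_, h3, fun h => ?_⟩
    · calc Q ≤ c * (n + 1) ^ 3 := h1.calls_le_steps.trans h2
        _ ≤ c * (8 * n ^ 3) := Nat.mul_le_mul_left _ hpow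
        _ = 8 * c * n ^ 3 := by ring
    · obtain ⟨h5, ℓ, S, h6, h7, h8⟩ := h4 h
      exact ⟨h5, ℓ, S, h6, h7.trans (Nat.mul_le_mul_right _ (by omega)), h8⟩
  obtain ⟨t, T, Q, ht, hT, hst, ht5⟩ := Runs.search hB hB' h0 (N := n + 2) (by omega)
  have hTb : T ≤ 8 * Prog.search.bound 1 * (n + 1) ^ 3 := by
    have h1 := Prog.search.bound_le (N := n + 2) (by omega)
    have h2 : Prog.search.depth = 3 := rfl
    rw [h2] at h1
    calc T ≤ Prog.search.bound 1 * (n + 2) ^ 3 := hT.trans h1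
      _ ≤ Prog.search.bound 1 * (2 * (n + 1)) ^ 3 := by gcongr; omega
      _ = _ := by ring
  have hpos : 1 ≤ (n + 1) ^ 3 := Nat.one_le_pow _ _ (by omega)
  have hn : ¬ (Test.eq (.reg 0) (.lit 0)).holds (initStore M B B') := by
    simp [Test.holds, Expr.val, initStore]; omega
  have hc1 : (Test.eq (.reg 0) (.lit 0)).cost = 3 := rfl
  have hc2 : (Test.eq (.reg 5) (.lit 1)).cost = 3 := rfl
  have hF : ∀ i < t.reg 6, LabelStep M (t.row n 3 i) (t.row n 3 (i + 1)) := hst.side₁.steps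
  have hG : ∀ i < t.reg 7, LabelStep M (t.row n 4 i) (t.row n 4 (i + 1)) := hst.side₂.steps
  have hF0 : t.row n 3 0 = fun x : Fin n => label B x := hst.side₁.first
  have hG0 : t.row n 4 0 = fun x : Fin n => label B' x := hst.side₂.first
  have hFl : t.row n 3 (t.reg 6) = t.row n 1 0 := hst.side₁.last
  have hGl : t.row n 4 (t.reg 7) = t.row n 2 0 := hst.side₂.last
  have len1 := hst.len₁
  have len2 := hst.len₂
  rcases hst.status with h5 | ⟨h5, heq⟩ | ⟨h5, hnr⟩
  · exact (ht5 h5).elim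
  · obtain ⟨u, T', Q', hu, hT', u0, u1, uF, uG⟩ := exec_output (O := basisOracle M) (s := t)
      hst.n_eq (by omega) (by rw [hFl, hGl, heq])
    obtain ⟨hbase, hseq⟩ := isReconfSeq_join (M := M) (F := t.row n 3) (G := t.row n 4)
      (a := t.reg 6) (b := t.reg 7) (H := u.row n 3)
      (by rw [hF0]; exact isBaseLabelling_label hB)
      (by rw [hG0]; exact isBaseLabelling_label hB') hF hG uF uG
    rw [hF0, hG0, classes_label hB, classes_label hB'] at hseq
    refine ⟨u, _, _, .ite_false hn (.seq ht (.ite_true (by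
      simpa [Test.holds, Expr.val] using h5) hu)), ?_, fun h => (h ⟨_, _, hseq⟩).elim, fun _ =>
      ⟨u0, _, _, hseq, ?_, u1, fun i hi x hx => ?_⟩⟩
    · rw [hc1, hc2, hc, add_mul, add_mul]
      omega
    · rw [sq]; omega
    · exact (label_classes (hbase i hi).le ⟨x, hx⟩).symm
  · refine ⟨_, _, _, .ite_false hn (.seq ht (.ite_false (by
      simp [Test.holds, Expr.val, h5]) (.set t 0 (.lit 0)))), ?_, fun _ => by
        simp [Store.setReg, Expr.val], fun hR => (hnr ?_).elim⟩
    · rw [hc1, hc2, hc, add_mul, add_mul]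
      simp only [Expr.cost]
      omega
    · -- go back to `B`, from there to `B'`, and on to the last labelling of side `2`
      have h1 := reflTransGen_step_symm (reflTransGen_of_labelStep hF)
      have h2 := reflTransGen_of_labelStep hG
      rw [hF0, hFl, classes_label hB] at h1
      rw [hG0, hGl, classes_label hB'] at h2
      exact (h1.trans hR.reflTransGen).trans h2
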